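/- **Theorem (Generalisations of Capparelli's identity).** Let $n$ be a positive integer. A colour is a symbol $a_kb_\ell$ with $k,\ell\in\mathbb{N}=\{0,1,2,\dots\}$; it is *free* if $k=\ell$ and *bound* if $k\neq\ell$. Let $\chi(P)$ be $1$ if $P$ is true and $0$ otherwise, and let $$\Delta(a_ib_k,a_{i'}b_{k'})=\chi(i\ge i')-\chi(i=k=i')+\chi(k\le k')-\chi(k=i'=k').$$ Let $\mathcal P_n$ be the set of coloured partitions $\lambda=\lambda_1+\cdots+\lambda_s$ ($s\ge 0$) into positive parts, each part having a colour $c(\lambda_j)\in\{a_ib_k:0\le i,k\le n-1\}$, such that $\lambda_j-\lambda_{j+1}\ge\Delta(c(\lambda_j),c(\lambda_{j+1}))$ for $1\le j\le s-1$. A part of size $p$ and colour $c$ is written $p_c$. Let $\delta$ be an integer-valued function on bound colours satisfying *Condition 1*: $\min\{k,\ell\}<\delta(a_kb_\ell)\le\max\{k,\ell\}$ for all $k\ne\ell$. Let $\gamma$ be an integer-valued function on pairs of bound colours satisfying *Condition 2*, where $\gamma$ is short for $\gamma(a_{k_1}b_{\ell_1},a_{k_2}b_{\ell_2})$: - if $\max\{k_1,\ell_2\}<\min\{k_2,\ell_1\}$,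 then $\max\{k_1,\ell_2\}<\gamma\le\min\{k_2,\ell_1\}$; - if $k_1>\ell_1$, $k_2>\ell_2$ and $\{\ell_2+1,\dots,k_2\}\setminus\{\ell_1+1,\dots,k_1\}\ne\emptyset$, then $\gamma\in\{\ell_2+1,\dots,k_2\}\setminus\{\ell_1+1,\dots,k_1\}$; - if $k_1<\ell_1$, $k_2<\ell_2$ and $\{k_1+1,\dots,\ell_1\}\setminus\{k_2+1,\dots,\ell_2\}\ne\emptyset$, then $\gamma\in\{k_1+1,\dots,\ell_1\}\setminus\{k_2+1,\dots,\ell_2\}$. Let $\mathcal C_n(\delta,\gamma)$ be the set of $\lambda\in\mathcal P_n$ that have no part coloured $a_0b_0$ and that contain none of the following patterns as consecutive parts, for any positive integer $p$: - $p_{a_ib_i}+p_{a_ib_i}$ for $1\le i\le n-1$; - $p_{a_{k_1}b_{\ell_1}}+p_{a_ib_i}+p_{a_{k_2}b_{\ell_2}}$ where $\max\{k_1,\ell_2\}<\min\{k_2,\ell_1\}$ and $i=\gamma(a_{k_1}b_{\ell_1},a_{k_2}b_{\ell_2})$; - for any $k_2>\ell_2$: - $(p+u)_{a_{k_1}b_{\ell_1}}+p_{a_ib_i}+p_{a_{k_2}b_{\ell_2}}$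 where $2\le u\le\infty$, $k_1,\ell_1$ are arbitrary and $i=\delta(a_{k_2}b_{\ell_2})$ (here $u=\infty$ means that $p_{a_ib_i}+p_{a_{k_2}b_{\ell_2}}$ is at the beginning of the partition); - $(p+1)_{a_{k_1}b_{\ell_1}}+p_{a_ib_i}+p_{a_{k_2}b_{\ell_2}}$ where $k_1\le\ell_1$ and $i=\delta(a_{k_2}b_{\ell_2})$; - $(p+1)_{a_{k_1}b_{\ell_1}}+p_{a_ib_i}+p_{a_{k_2}b_{\ell_2}}$ where $k_1>\ell_1$, $\{\ell_2+1,\dots,k_2\}\setminus\{\ell_1+1,\dots,k_1\}\neq\emptyset$ and $i=\gamma(a_{k_1}b_{\ell_1},a_{k_2}b_{\ell_2})$; - for any $k_1<\ell_1$: - $p_{a_{k_1}b_{\ell_1}}+p_{a_ib_i}+(p-u)_{a_{k_2}b_{\ell_2}}$ where $2\le u\le\infty$, $k_2,\ell_2$ are arbitrary and $i=\delta(a_{k_1}b_{\ell_1})$ (here $u=\infty$ means that $p_{a_{k_1}b_{\ell_1}}+p_{a_ib_i}$ is at the end of the partition); - $(p+1)_{a_{k_1}b_{\ell_1}}+(p+1)_{a_ib_i}+p_{a_{k_2}b_{\ell_2}}$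 where $k_2\ge\ell_2$ and $i=\delta(a_{k_1}b_{\ell_1})$; - $(p+1)_{a_{k_1}b_{\ell_1}}+(p+1)_{a_ib_i}+p_{a_{k_2}b_{\ell_2}}$ where $k_2<\ell_2$, $\{k_1+1,\dots,\ell_1\}\setminus\{k_2+1,\dots,\ell_2\}\neq\emptyset$ and $i=\gamma(a_{k_1}b_{\ell_1},a_{k_2}b_{\ell_2})$. An *$n^2$-coloured Frobenius partition* is a two-rowed array $\begin{pmatrix}\lambda_1&\cdots&\lambda_s\\ \mu_1&\cdots&\mu_s\end{pmatrix}$, $s\ge0$, where $\lambda_1>\cdots>\lambda_s$ are non-negative integers coloured with $a_0,\dots,a_{n-1}$, strictly decreasing for the order $0_{a_{n-1}}<\cdots<0_{a_0}<1_{a_{n-1}}<\cdots<1_{a_0}<\cdots$, and $\mu_1>\cdots>\mu_s$ are non-negative integers coloured with $b_0,\dots,b_{n-1}$, strictly decreasing for the order $0_{b_0}<\cdots<0_{b_{n-1}}<1_{b_0}<\cdots<1_{b_{n-1}}<\cdots$. It is a Frobenius partition of $m=s+\sum_j\lambda_j+\sum_j\mu_j$. For $u,v\in\mathbb{N}^n$,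 let $C_n(\delta,\gamma;m;u;v)$ be the number of partitions of $m$ in $\mathcal C_n(\delta,\gamma)$, and $F_n(m;u;v)$ the number of $n^2$-coloured Frobenius partitions of $m$, in whose colours, for every $i\in\{0,\dots,n-1\}$, the symbol $a_i$ appears $u_i$ times and the symbol $b_i$ appears $v_i$ times. Let $(a;q)_\infty=\prod_{k\ge0}(1-aq^k)$, and let $[x^0]$ denote the extraction of the coefficient of $x^0$. Then, setting $b_i=a_i^{-1}$ for all $i$, the following hold as identities of formal power series in $q$ with coefficients in $\mathbb{Z}[a_0^{\pm1},\dots,a_{n-1}^{\pm1}]$: \begin{align*} &\sum_{m\ge0}\ \sum_{u,v\in\mathbb{N}^n} C_n(\delta,\gamma;m;u;v)\,q^m a_0^{u_0-v_0}\cdots a_{n-1}^{u_{n-1}-v_{n-1}}\\ &\qquad=(q;q)_\infty\sum_{m\ge0}\ \sum_{u,v\in\mathbb{N}^n}F_n(m;u;v)\,q^m a_0^{u_0-v_0}\cdots a_{n-1}^{u_{n-1}-v_{n-1}}\\ &\qquad=(q;q)_\infty\,[x^0]\prod_{i=0}^{n-1}(-xa_iq;q)_\infty(-x^{-1}a_i^{-1};q)_\infty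 . \end{align*} -/

import Mathlib

namespace Capparelli

/-- The colour `a_k b_l` is the pair `(k, l)`; it is free if `k = l` and bound if `k ≠ l`. -/
abbrev Colour : Type := ℕ × ℕ

/-- A coloured part `p_c`: an integer (its size) with a colour. -/
structure Part : Type where
  size : ℕ
  colour : Colour

/-- The part `p` in the colour `a_k b_l`. -/
abbrev part (p k l : ℕ) : Part := ⟨p, (k, l)⟩

/-- The minimal difference
`Δ(a_i b_k, a_i' b_k') = χ(i ≥ i') - χ(i = k = i') + χ(k ≤ k') - χ(k = i' = k')`. -/
def Delta (c c' : Colour) : ℤ :=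
  (if c'.1 ≤ c.1 then 1 else 0) - (if c.1 = c.2 ∧ c.2 = c'.1 then 1 else 0)
    + (if c.2 ≤ c'.2 then 1 else 0) - (if c.2 = c'.1 ∧ c'.1 = c'.2 then 1 else 0)

/-- Generalised Primc partitions (the set `𝒫_n`), written `λ_1 + ⋯ + λ_s` as the list
`[λ_1, …, λ_s]`. -/
structure IsPrimc (n : ℕ) (l : List Part) : Prop where
  size_pos : ∀ x ∈ l, 1 ≤ x.size
  colour_lt : ∀ x ∈ l, x.colour.1 < n ∧ x.colour.2 < n
  difference : l.IsChain fun x y => Delta x.colour y.colour ≤ (x.size : ℤ) - (y.size : ℤ)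

/-- Condition 1. Only the values of `δ` at the bound colours matter, here and below. -/
def Condition1 (δ : Colour → ℤ) : Prop :=
  ∀ k l : ℕ, k ≠ l → ((min k l : ℕ) : ℤ) < δ (k, l) ∧ δ (k, l) ≤ ((max k l : ℕ) : ℤ)

/-- The set of integers `{l + 1, …, k}`. -/
def interval (l k : ℕ) : Set ℤ := Set.Icc ((l : ℤ) + 1) (k : ℤ)

/-- Condition 2. Only the values of `γ` at pairs of bound colours matter, here and below. -/
structure Condition2 (γ : Colour → Colour → ℤ) : Prop where
  max_lt_min : ∀ k₁ l₁ k₂ l₂ : ℕ, max k₁ l₂ < min k₂ l₁ →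
    ((max k₁ l₂ : ℕ) : ℤ) < γ (k₁, l₁) (k₂, l₂) ∧ γ (k₁, l₁) (k₂, l₂) ≤ ((min k₂ l₁ : ℕ) : ℤ)
  gt_gt : ∀ k₁ l₁ k₂ l₂ : ℕ, l₁ < k₁ → l₂ < k₂ →
    (interval l₂ k₂ \ interval l₁ k₁).Nonempty →
    γ (k₁, l₁) (k₂, l₂) ∈ interval l₂ k₂ \ interval l₁ k₁
  lt_lt : ∀ k₁ l₁ k₂ l₂ : ℕ, k₁ < l₁ → k₂ < l₂ →
    (interval k₁ l₁ \ interval k₂ l₂).Nonempty →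
    γ (k₁, l₁) (k₂, l₂) ∈ interval k₁ l₁ \ interval k₂ l₂

/-- Generalised Capparelli partitions (the set `𝒞_n(δ, γ)`). A partition contains the pattern
`π` if `π <:+: l`, i.e. `π` occurs in it as consecutive parts; `<+:` and `<:+` say that the
pattern occurs at the beginning, or at the end (the cases `u = ∞`). All parts being positive and
in colours with indices `< n`, the patterns need no bounds on `p`, `k₁`, `l₁`, `k₂`, `l₂`. -/
structure IsCapparelli (n : ℕ) (δ : Colour → ℤ) (γ : Colour → Colour → ℤ) (l : List Part) :
    Prop where
  primc : IsPrimc n l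
  no_zero : ∀ x ∈ l, x.colour ≠ (0, 0)
  no_repeat : ∀ p i : ℕ, 1 ≤ i → i < n → ¬ [part p i i, part p i i] <:+: l
  avoid_middle : ∀ p k₁ l₁ k₂ l₂ i : ℕ, max k₁ l₂ < min k₂ l₁ →
    (i : ℤ) = γ (k₁, l₁) (k₂, l₂) →
    ¬ [part p k₁ l₁, part p i i, part p k₂ l₂] <:+: l
  avoid_left_far : ∀ p u k₁ l₁ k₂ l₂ i : ℕ, l₂ < k₂ → 2 ≤ u → (i : ℤ) = δ (k₂, l₂) →
    ¬ [part (p + u) k₁ l₁, part p i i, part p k₂ l₂] <:+: l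
  avoid_left_end : ∀ p k₂ l₂ i : ℕ, l₂ < k₂ → (i : ℤ) = δ (k₂, l₂) →
    ¬ [part p i i, part p k₂ l₂] <+: l
  avoid_left_le : ∀ p k₁ l₁ k₂ l₂ i : ℕ, l₂ < k₂ → k₁ ≤ l₁ → (i : ℤ) = δ (k₂, l₂) →
    ¬ [part (p + 1) k₁ l₁, part p i i, part p k₂ l₂] <:+: l
  avoid_left_gt : ∀ p k₁ l₁ k₂ l₂ i : ℕ, l₂ < k₂ → l₁ < k₁ →
    (interval l₂ k₂ \ interval l₁ k₁).Nonempty → (i : ℤ) = γ (k₁, l₁) (k₂, l₂) →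
    ¬ [part (p + 1) k₁ l₁, part p i i, part p k₂ l₂] <:+: l
  avoid_right_far : ∀ p u k₁ l₁ k₂ l₂ i : ℕ, k₁ < l₁ → 2 ≤ u → (i : ℤ) = δ (k₁, l₁) →
    ¬ [part (p + u) k₁ l₁, part (p + u) i i, part p k₂ l₂] <:+: l
  avoid_right_end : ∀ p k₁ l₁ i : ℕ, k₁ < l₁ → (i : ℤ) = δ (k₁, l₁) →
    ¬ [part p k₁ l₁, part p i i] <:+ l
  avoid_right_ge : ∀ p k₁ l₁ k₂ l₂ i : ℕ, k₁ < l₁ → l₂ ≤ k₂ → (i : ℤ) = δ (k₁, l₁) →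
    ¬ [part (p + 1) k₁ l₁, part (p + 1) i i, part p k₂ l₂] <:+: l
  avoid_right_lt : ∀ p k₁ l₁ k₂ l₂ i : ℕ, k₁ < l₁ → k₂ < l₂ →
    (interval k₁ l₁ \ interval k₂ l₂).Nonempty → (i : ℤ) = γ (k₁, l₁) (k₂, l₂) →
    ¬ [part (p + 1) k₁ l₁, part (p + 1) i i, part p k₂ l₂] <:+: l

/-- The generalised Capparelli partitions of `m` in which, for every `i < n`, the symbol `a_i`
appears `u i` times and the symbol `b_i = a_i⁻¹` appears `v i` times in the colours. -/
def capparelliSet (n : ℕ) (δ : Colour → ℤ) (γ : Colour → Colour → ℤ) (m : ℕ)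
    (u v : Fin n → ℕ) : Set (List Part) :=
  {l | IsCapparelli n δ γ l ∧ (l.map Part.size).sum = m ∧
    (∀ i : Fin n, l.countP (fun x : Part => decide (x.colour.1 = (i : ℕ))) = u i) ∧
    (∀ i : Fin n, l.countP (fun x : Part => decide (x.colour.2 = (i : ℕ))) = v i)}

/-- The number `C_n(δ, γ; m; u; v)`. -/
noncomputable def capparelliCount (n : ℕ) (δ : Colour → ℤ) (γ : Colour → Colour → ℤ) (m : ℕ)
    (u v : Fin n → ℕ) : ℕ :=
  (capparelliSet n δ γ m u v).ncard

/-- An `n²`-coloured Frobenius partition: two rows of equal length. A pair `(p, i)` in the upper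
row is the non-negative integer `p` in the colour `a_i`, in the lower row it is `p` in the colour
`b_i`. Both rows are strictly decreasing for the orders
`0_{a_{n-1}} < ⋯ < 0_{a_0} < 1_{a_{n-1}} < ⋯` and `0_{b_0} < ⋯ < 0_{b_{n-1}} < 1_{b_0} < ⋯`. -/
structure Frobenius (n : ℕ) : Type where
  upper : List (ℕ × Fin n)
  lower : List (ℕ × Fin n)
  length_eq : upper.length = lower.length
  upper_decreasing : upper.Pairwise fun x y => y.1 < x.1 ∨ (y.1 = x.1 ∧ x.2 < y.2)
  lower_decreasing : lower.Pairwise fun x y => y.1 < x.1 ∨ (y.1 = x.1 ∧ y.2 < x.2)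

/-- The weight `s + ∑ λ_i + ∑ μ_i`. -/
def Frobenius.weight {n : ℕ} (f : Frobenius n) : ℕ :=
  f.upper.length + (f.upper.map Prod.fst).sum + (f.lower.map Prod.fst).sum

/-- The `n²`-coloured Frobenius partitions of `m` in which, for every `i < n`, the symbol `a_i`
appears `u i` times and the symbol `b_i = a_i⁻¹` appears `v i` times in the colours. -/
def frobeniusSet (n m : ℕ) (u v : Fin n → ℕ) : Set (Frobenius n) :=
  {f | f.weight = m ∧
    (∀ i : Fin n, f.upper.countP (fun x => decide (x.2 = i)) = u i) ∧
    (∀ i : Fin n, f.lower.countP (fun x => decide (x.2 = i)) = v i)}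

/-- The number `F_n(m; u; v)`. -/
noncomputable def frobeniusCount (n m : ℕ) (u v : Fin n → ℕ) : ℕ :=
  (frobeniusSet n m u v).ncard

/-- The ring `ℤ[a_0^{±1}, …, a_{n-1}^{±1}]` of Laurent polynomials. -/
abbrev ColourRing (n : ℕ) : Type := AddMonoidAlgebra ℤ (Fin n → ℤ)

/-- The monomial `a_0^{e_0} ⋯ a_{n-1}^{e_{n-1}}`. -/
noncomputable def monom {n : ℕ} (e : Fin n → ℤ) : ColourRing n := AddMonoidAlgebra.single e 1

/-- The series `∑_{m, u, v ≥ 0} N(m; u; v) q^m a_0^{u_0 - v_0} ⋯ a_{n-1}^{u_{n-1} - v_{n-1}}`,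
where the power series variable is `q`, for a function `N` that is finitely supported in `(u, v)`
for each `m`. -/
noncomputable def genSeries {n : ℕ} (N : ℕ → (Fin n → ℕ) → (Fin n → ℕ) → ℕ) :
    PowerSeries (ColourRing n) :=
  PowerSeries.mk fun m => ∑ᶠ w : (Fin n → ℕ) × (Fin n → ℕ),
    (N m w.1 w.2 : ColourRing n) * monom fun i => (w.1 i : ℤ) - (w.2 i : ℤ)

/-- The infinite `q`-Pochhammer symbol `(a; q)_∞ = ∏_{k ≥ 0} (1 - a q^k)` in `R⟦q⟧`, a product
that converges `q`-adically, i.e. for the topology of coefficientwise convergence with `R`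
discrete. -/
noncomputable def qPochhammer {R : Type} [CommRing R] (a : PowerSeries R) : PowerSeries R :=
  letI : TopologicalSpace R := ⊥
  letI : TopologicalSpace (PowerSeries R) := PowerSeries.WithPiTopology.instTopologicalSpace R
  ∏' k : ℕ, (1 - a * PowerSeries.X ^ k)

/-- The ring `ℤ[a_0^{±1}, …, a_{n-1}^{±1}][x^{±1}]`. -/
abbrev XRing (n : ℕ) : Type := LaurentPolynomial (ColourRing n)

/-- The product `∏_{i=0}^{n-1} (-x a_i q; q)_∞ (-x⁻¹ a_i⁻¹; q)_∞`. -/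
noncomputable def frobeniusProduct (n : ℕ) : PowerSeries (XRing n) :=
  ∏ i : Fin n,
    (qPochhammer (-(PowerSeries.C
        (LaurentPolynomial.T 1 * LaurentPolynomial.C (monom (Pi.single i 1))) * PowerSeries.X)) *
      qPochhammer (-(PowerSeries.C
        (LaurentPolynomial.T (-1) * LaurentPolynomial.C (monom (Pi.single i (-1)))))))

/-- `[x^0] f`, the coefficient of `x^0` in a power series in `q` whose coefficients are Laurent
polynomials in `x`. -/
noncomputable def coeffX0 {n : ℕ} (f : PowerSeries (XRing n)) : PowerSeries (ColourRing n) :=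
  PowerSeries.mk fun m => (PowerSeries.coeff m f).coeff 0

/-! The infinite products converge, and the sums over `u`, `v` and the counts are finite. -/

theorem multipliable_qPochhammer {R : Type} [CommRing R] (a : PowerSeries R) :
    letI : TopologicalSpace R := ⊥
    letI : TopologicalSpace (PowerSeries R) := PowerSeries.WithPiTopology.instTopologicalSpace R
    Multipliable fun k : ℕ => (1 - a * PowerSeries.X ^ k : PowerSeries R) := by
  let : TopologicalSpace R := ⊥
  let : TopologicalSpace (PowerSeries R) := PowerSeries.WithPiTopology.instTopologicalSpace R
  have h : Multipliable fun k : ℕ => (1 + -(a * PowerSeries.X ^ k) : PowerSeries R) := by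
    nontriviality R
    apply PowerSeries.WithPiTopology.multipliable_one_add_of_tendsto_order_atTop_nhds_top
    refine ENat.tendsto_nhds_top_iff_natCast_lt.mpr fun n =>
      Filter.eventually_atTop.mpr ⟨n + 1, fun m hm => ?_⟩
    rw [PowerSeries.order_neg]
    refine lt_of_lt_of_le (b := (m : ℕ∞)) (by exact_mod_cast hm) ?_
    refine le_trans ?_ (PowerSeries.le_order_mul _ _)
    rw [PowerSeries.order_X_pow]
    exact le_add_self
  simpa only [sub_eq_add_neg] using h

theorem finite_lists {α : Type} {s : Set α} (hs : s.Finite) (m : ℕ) :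
    {l : List α | l.length ≤ m ∧ ∀ x ∈ l, x ∈ s}.Finite := by
  have : Finite s := hs
  refine ((List.finite_length_le s m).image (List.map Subtype.val)).subset ?_
  rintro l ⟨h1, h2⟩
  exact ⟨l.pmap Subtype.mk h2, by simpa using h1, by simp [List.map_pmap]⟩

theorem finite_capparelli (n m : ℕ) (δ : Colour → ℤ) (γ : Colour → Colour → ℤ) :
    {l : List Part | IsCapparelli n δ γ l ∧ (l.map Part.size).sum = m}.Finite := by
  have hs : {x : Part | x.size ≤ m ∧ x.colour.1 < n ∧ x.colour.2 < n}.Finite := by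
    refine (((Set.finite_Iic m).prod ((Set.finite_Iio n).prod (Set.finite_Iio n))).image
      fun t : ℕ × ℕ × ℕ => (⟨t.1, t.2⟩ : Part)).subset ?_
    rintro ⟨p, k, l⟩ h
    exact ⟨(p, k, l), by simpa using h, rfl⟩
  refine (finite_lists hs m).subset ?_
  rintro l ⟨h, rfl⟩
  refine ⟨?_, fun x hx => ⟨List.le_sum_of_mem (List.mem_map_of_mem hx), h.primc.colour_lt x hx⟩⟩
  have := List.card_nsmul_le_sum (l.map Part.size) 1 (by simpa using h.primc.size_pos)
  simpa using this

theorem finite_frobenius (n m : ℕ) : {f : Frobenius n | f.weight = m}.Finite := by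
  have hs : {x : ℕ × Fin n | x.1 ≤ m}.Finite := by
    refine ((Set.finite_Iic m).prod (Set.finite_univ (α := Fin n))).subset ?_
    intro x hx
    exact ⟨hx, trivial⟩
  have hL := finite_lists hs m
  refine Set.Finite.of_finite_image (f := fun f => (f.upper, f.lower)) ((hL.prod hL).subset ?_) ?_
  · rintro _ ⟨f, rfl, rfl⟩
    have e := f.length_eq
    have hw : f.weight = f.upper.length + (f.upper.map Prod.fst).sum
      + (f.lower.map Prod.fst).sum := rfl
    refine ⟨⟨by simp only; omega, fun x hx => ?_⟩, ⟨by simp only; omega, fun x hx => ?_⟩⟩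
    · change x ∈ f.upper at hx
      have := List.le_sum_of_mem (List.mem_map_of_mem (f := Prod.fst) hx)
      change x.1 ≤ f.weight
      omega
    · change x ∈ f.lower at hx
      have := List.le_sum_of_mem (List.mem_map_of_mem (f := Prod.fst) hx)
      change x.1 ≤ f.weight
      omega
  · rintro ⟨u, v, _, _, _⟩ - ⟨u', v', _, _, _⟩ - h
    simp only [Prod.mk.injEq] at h
    obtain ⟨rfl, rfl⟩ := h
    rfl

theorem finite_support_capparelliCount (n m : ℕ) (δ : Colour → ℤ) (γ : Colour → Colour → ℤ) :
    {w : (Fin n → ℕ) × (Fin n → ℕ) | capparelliCount n δ γ m w.1 w.2 ≠ 0}.Finite := by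
  refine ((finite_capparelli n m δ γ).image fun l =>
    (fun i : Fin n => l.countP (fun x : Part => decide (x.colour.1 = (i : ℕ))),
     fun i : Fin n => l.countP (fun x : Part => decide (x.colour.2 = (i : ℕ))))).subset ?_
  rintro ⟨u, v⟩ hw
  obtain ⟨l, h1, h2, h3, h4⟩ := Set.nonempty_of_ncard_ne_zero hw
  exact ⟨l, ⟨h1, h2⟩, Prod.ext (funext h3) (funext h4)⟩

theorem finite_support_frobeniusCount (n m : ℕ) :
    {w : (Fin n → ℕ) × (Fin n → ℕ) | frobeniusCount n m w.1 w.2 ≠ 0}.Finite := by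
  refine ((finite_frobenius n m).image fun f =>
    (fun i : Fin n => f.upper.countP (fun x => decide (x.2 = i)),
     fun i : Fin n => f.lower.countP (fun x => decide (x.2 = i)))).subset ?_
  rintro ⟨u, v⟩ hw
  obtain ⟨l, h1, h2, h3⟩ := Set.nonempty_of_ncard_ne_zero hw
  exact ⟨l, h1, Prod.ext (funext h2) (funext h3)⟩

end Capparelli

/-! With `b_i = a_i⁻¹` every free part has colour weight 1. The proof has two independent halves.

Primc half (`listSeries_isPrimc`): the series of `𝒫_n` is `[x^0]` of the product. Let `L_N(c)` be
the series of chains of `N` parts, size 0 allowed, that may precede a last part `0_c` (`chainSet`).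
Lowering all parts together until the smallest one is minimal gives `(1 - q^(N+1)) L_{N+1}(c) =
∑_{c'} c' q^((N+1) Δ(c', c)) L_N(c')`. The solution is `(q; q)_N` times the coefficient of `x^N y^N`
in a product of a row in `x`, a row in `y` and `1/(xy; q)_∞` or `1/(xyq; q)_∞`
(`RowData.closed_form`): `Δ` is a sum of two indicators, so the sum over `c'` becomes two nested
telescoping sums (`RowData.odd_step`, `RowData.even_step`). For `c = a_0 b_0` the only parts of size
0 are `0_{a_0 b_0}`, of weight 1, so `L_N` is the series of Primc partitions with at most `N` parts.
As `N` grows, what remains is the sum over `r` of the products of the `r`-th coefficients of the two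
rows, that is, the coefficient of `x^0`. Expanding the rows over finite sets of coloured integers
gives the Frobenius partitions (`genSeries_frobeniusCount`).

Capparelli half (`listSeries_isCapparelli`): in a Primc partition the free parts of size `M` are
consecutive and of one colour, and their place is determined by the other parts. By Conditions 1 and
2, `δ` and `γ` choose an admissible colour for a free part between two given neighbours; where
neither applies, `a_0 b_0` is chosen. Call a partition good at `M` if it has at most one free part
of size `M`, and not of the chosen colour. Avoiding the patterns means being good at all `M`
(`isCapparelli_iff`). The partitions that are not good at `M` arise, each exactly once, by inserting
a free part of size `M` (`goodBelow_eq_union`), so goodness at `M` costs a factor `1 - q^M`, and all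
`M` together cost `(q; q)_∞`. -/

namespace Capparelli

/-! ### The recurrence of Primc partitions, solved by telescoping. -/

/-- The minimal difference as a natural number. -/
def deltaNat (c c' : Colour) : ℕ :=
  (if c'.1 ≤ c.1 ∧ ¬ (c.1 = c.2 ∧ c.2 = c'.1) then 1 else 0)
    + (if c.2 ≤ c'.2 ∧ ¬ (c.2 = c'.1 ∧ c'.1 = c'.2) then 1 else 0)

/-- Each indicator subtracted in `Delta` implies the indicator added just before it. -/
theorem coe_deltaNat (c c' : Colour) : (deltaNat c c' : ℤ) = Delta c c' := by
  unfold deltaNat Delta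
  split_ifs <;> simp <;> omega

/-- The two stretches telescope to `f K - f 0` and `Q * (f n - f K)`; the quasi-periodicity `h`
cancels the boundary terms. -/
theorem sum_telescope_ge {A : Type*} [CommRing A] (n K : ℕ) (hK : K ≤ n) (Q : A) (f : ℕ → A)
    (h : Q * f n = f 0) :
    ∑ k ∈ Finset.range n, Q ^ (if K ≤ k then 1 else 0) * (f (k + 1) - f k) = (1 - Q) * f K := by
  have key : ∀ m, K ≤ m → ∑ k ∈ Finset.range m, Q ^ (if K ≤ k then 1 else 0) * (f (k + 1) - f k)
      = f K - f 0 + Q * (f m - f K) := by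
    intro m hm
    induction m, hm using Nat.le_induction with
    | base =>
      rw [sub_self, mul_zero, add_zero, ← Finset.sum_range_sub]
      refine Finset.sum_congr rfl fun k hk => ?_
      rw [if_neg (by simpa using hk), pow_zero, one_mul]
    | succ m hm ih => rw [Finset.sum_range_succ, ih, if_pos hm]; ring
  rw [key n hK]
  linear_combination h

theorem sum_telescope_lt {A : Type*} [CommRing A] (n K : ℕ) (hK : K ≤ n) (Q : A) (f : ℕ → A)
    (h : Q * f 0 = f n) :
    ∑ k ∈ Finset.range n, Q ^ (if k < K then 1 else 0) * (f k - f (k + 1)) = (1 - Q) * f K := by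
  have key : ∀ m, K ≤ m → ∑ k ∈ Finset.range m, Q ^ (if k < K then 1 else 0) * (f k - f (k + 1))
      = Q * (f 0 - f K) + (f K - f m) := by
    intro m hm
    induction m, hm using Nat.le_induction with
    | base =>
      rw [sub_self, add_zero, ← Finset.sum_range_sub', Finset.mul_sum]
      refine Finset.sum_congr rfl fun k hk => ?_
      rw [if_pos (by simpa using hk), pow_one]
    | succ m hm ih => rw [Finset.sum_range_succ, ih, if_neg (by omega)]; ring
  rw [key n hK]
  linear_combination h

/-- The data of the row generating functions: `ε k r` is the coefficient of `x ^ r` in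
`∏_{i < k} (-x a_i; q)_∞ ∏_{i ≥ k} (-x a_i q; q)_∞`, `η m r` that of `x ^ r` in
`∏_{i < m} (-x b_i q; q)_∞ ∏_{i ≥ m} (-x b_i; q)_∞`, and `d j = 1 / (q; q)_j`. -/
structure RowData {A : Type*} [CommRing A] (n : ℕ) (q : A) (a b : ℕ → A) (ε η : ℕ → ℕ → A)
    (d : ℕ → A) : Prop where
  ab : ∀ k, a k * b k = 1
  ε_zero : ∀ k, ε k 0 = 1
  η_zero : ∀ k, η k 0 = 1
  ε_succ : ∀ k < n, ∀ r, ε (k + 1) (r + 1) = ε k (r + 1) + a k * ε k r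
  η_succ : ∀ k < n, ∀ r, η k (r + 1) = η (k + 1) (r + 1) + b k * η (k + 1) r
  ε_scale : ∀ r, q ^ r * ε n r = ε 0 r
  η_scale : ∀ r, q ^ r * η 0 r = η n r
  d_zero : d 0 = 1
  d_succ : ∀ j, (1 - q ^ (j + 1)) * d (j + 1) = d j

section
variable {A : Type*} [CommRing A] {n : ℕ} {q : A} {a b : ℕ → A} {ε η : ℕ → ℕ → A} {d : ℕ → A}

/-- The coefficient of `x ^ (N + 1) y ^ N` in the product of a row `a`, a row `b` and
`1 / (x y; q)_∞`. -/
def oddCoeff (q : A) (ε η : ℕ → ℕ → A) (d : ℕ → A) (N l m : ℕ) : A :=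
  ∑ j ∈ Finset.range (N + 1),
    ε m (N + 1 - j) * η (l + 1) (N - j) * ((if m ≤ l then q ^ j else 1) * d j)

/-- The coefficient of `x ^ N y ^ N` in the product of a row `a`, a row `b` and
`1 / (x y; q)_∞`. -/
def evenCoeff (q : A) (ε η : ℕ → ℕ → A) (d : ℕ → A) (N k m : ℕ) : A :=
  ∑ j ∈ Finset.range (N + 1),
    ε k (N - j) * η m (N - j) * ((if k < m then q ^ j else 1) * d j)

/-- Going from `n` to `0` replaces `x` by `x q` in the row `a`, which gives `q ^ (N + 1 - j)`; the
missing `q ^ j` comes from `1/(xy; q)_∞` becoming `1/(xyq; q)_∞`. -/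
theorem RowData.odd_scale (h : RowData n q a b ε η d) (N l : ℕ) (hl : l < n) :
    q ^ (N + 1) * oddCoeff q ε η d N l n = oddCoeff q ε η d N l 0 := by
  unfold oddCoeff
  rw [Finset.mul_sum]
  refine Finset.sum_congr rfl fun j hj => ?_
  rw [if_neg (by omega), if_pos (by omega), ← h.ε_scale]
  have : q ^ (N + 1) = q ^ (N + 1 - j) * q ^ j := by
    rw [← pow_add]; congr 1; simp at hj; omega
  rw [this]; ring

theorem RowData.even_scale (h : RowData n q a b ε η d) (N k : ℕ) (hk : k < n) :
    q ^ N * evenCoeff q ε η d N k 0 = evenCoeff q ε η d N k n := by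
  unfold evenCoeff
  rw [Finset.mul_sum]
  refine Finset.sum_congr rfl fun j hj => ?_
  rw [if_neg (by omega), if_pos (by omega), ← h.η_scale]
  have : q ^ N = q ^ (N - j) * q ^ j := by
    rw [← pow_add]; congr 1; simp at hj; omega
  rw [this]; ring

/-- For `k ≠ l` only the factor `1 + x a_k` of the row changes. For `k = l` the third factor changes
too, from `1/(xyq; q)_∞` to `1/(xy; q)_∞`, and `(1 + x a_k) - (1 - x y) = x a_k (1 + y b_k)` because
`a_k b_k = 1`; the factor `1 + y b_k` moves the row `b` from `k + 1` to `k`. -/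
theorem RowData.odd_step (h : RowData n q a b ε η d) (N k l : ℕ) (hk : k < n) :
    a k * evenCoeff q ε η d N k (if k = l then l else l + 1)
      = oddCoeff q ε η d N l (k + 1) - oddCoeff q ε η d N l k := by
  unfold oddCoeff evenCoeff
  rw [Finset.mul_sum, ← Finset.sum_sub_distrib]
  rcases lt_trichotomy k l with hkl | rfl | hkl
  · refine Finset.sum_congr rfl fun j hj => ?_
    obtain ⟨r, rfl⟩ : ∃ r, N = j + r := ⟨N - j, by simp at hj; omega⟩
    rw [if_neg hkl.ne, if_pos (by omega), if_pos (by omega), if_pos (by omega),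
      show j + r + 1 - j = r + 1 by omega, show j + r - j = r by omega, h.ε_succ k hk]
    ring
  · simp only [if_true, lt_irrefl, if_false, le_refl]
    have e1 : ∀ j ∈ Finset.range (N + 1),
        ε (k + 1) (N + 1 - j) * η (k + 1) (N - j) * ((if k + 1 ≤ k then q ^ j else 1) * d j)
          - ε k (N + 1 - j) * η (k + 1) (N - j) * (q ^ j * d j)
        = a k * ε k (N - j) * η (k + 1) (N - j) * d j
          + ε k (N + 1 - j) * η (k + 1) (N - j) * ((1 - q ^ j) * d j) := by
      intro j hj
      obtain ⟨r, rfl⟩ : ∃ r, N = j + r := ⟨N - j, by simp at hj; omega⟩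
      rw [if_neg (by omega), show j + r + 1 - j = r + 1 by omega, show j + r - j = r by omega,
        h.ε_succ k hk]
      ring
    rw [Finset.sum_congr rfl e1, Finset.sum_add_distrib]
    -- Multiplication by `1 - (1 - x y)`: the term `j = 0` vanishes, and `(1 - q^(j+1)) d_{j+1} =
    -- d_j` shifts the others.
    rw [Finset.sum_range_succ' (fun j => ε k (N + 1 - j) * η (k + 1) (N - j) * ((1 - q ^ j) * d j))]
    rw [Finset.sum_range_succ, Finset.sum_range_succ]
    simp only [h.d_succ, pow_zero, sub_self, Nat.sub_self, zero_mul, mul_zero, add_zero, h.η_zero]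
    rw [add_right_comm, ← Finset.sum_add_distrib]
    congr 1
    · refine Finset.sum_congr rfl fun j hj => ?_
      obtain ⟨r, rfl⟩ : ∃ r, N = j + (r + 1) := ⟨N - j - 1, by simp at hj; omega⟩
      rw [show j + (r + 1) - j = r + 1 by omega, show j + (r + 1) + 1 - (j + 1) = r + 1 by omega,
        show j + (r + 1) - (j + 1) = r by omega, h.η_succ k hk]
      linear_combination (ε k (r + 1) * η (k + 1) r * d j) * h.ab k
    · ring
  · refine Finset.sum_congr rfl fun j hj => ?_
    obtain ⟨r, rfl⟩ : ∃ r, N = j + r := ⟨N - j, by simp at hj; omega⟩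
    rw [if_neg hkl.ne', if_neg (by omega), if_neg (by omega), if_neg (by omega),
      show j + r + 1 - j = r + 1 by omega, show j + r - j = r by omega, h.ε_succ k hk]
    ring

/-- The mirror image of `odd_step`: for `k = l` the identity is `(1 + y b_k) - (1 - x y) = y b_k (1
+ x a_k)`. -/
theorem RowData.even_step (h : RowData n q a b ε η d) (N k l : ℕ) (hl : l < n) :
    b l * oddCoeff q ε η d N l (if k = l then l + 1 else k)
      = evenCoeff q ε η d (N + 1) k l - evenCoeff q ε η d (N + 1) k (l + 1) := by
  unfold oddCoeff evenCoeff
  rw [Finset.mul_sum, ← Finset.sum_sub_distrib]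
  rcases lt_trichotomy k l with hkl | rfl | hkl
  · rw [Finset.sum_range_succ _ (N + 1)]
    simp only [Nat.sub_self, h.η_zero]
    rw [if_pos hkl, if_pos (by omega : k < l + 1), sub_self, add_zero]
    refine Finset.sum_congr rfl fun j hj => ?_
    obtain ⟨r, rfl⟩ : ∃ r, N = j + r := ⟨N - j, by simp at hj; omega⟩
    rw [if_neg hkl.ne, if_pos (by omega), if_pos (by omega), if_pos (by omega),
      show j + r + 1 - j = r + 1 by omega, show j + r - j = r by omega, h.η_succ l hl]
    ring
  · simp only [if_true, lt_irrefl, if_false]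
    have e1 : ∀ j ∈ Finset.range (N + 1 + 1),
        ε k (N + 1 - j) * η k (N + 1 - j) * (1 * d j)
          - ε k (N + 1 - j) * η (k + 1) (N + 1 - j) * ((if k < k + 1 then q ^ j else 1) * d j)
        = ε k (N + 1 - j) * (η k (N + 1 - j) - η (k + 1) (N + 1 - j)) * d j
          + ε k (N + 1 - j) * η (k + 1) (N + 1 - j) * ((1 - q ^ j) * d j) := by
      intro j hj
      rw [if_pos (by omega)]
      ring
    rw [Finset.sum_congr rfl e1, Finset.sum_add_distrib]
    rw [Finset.sum_range_succ'
      (fun j => ε k (N + 1 - j) * η (k + 1) (N + 1 - j) * ((1 - q ^ j) * d j))]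
    rw [Finset.sum_range_succ _ (N + 1)]
    simp only [h.d_succ, pow_zero, sub_self, Nat.sub_self, zero_mul, mul_zero, add_zero, h.η_zero]
    rw [← Finset.sum_add_distrib]
    refine Finset.sum_congr rfl fun j hj => ?_
    obtain ⟨r, rfl⟩ : ∃ r, N = j + r := ⟨N - j, by simp at hj; omega⟩
    rw [if_neg (by omega), show j + r + 1 - j = r + 1 by omega, show j + r - j = r by omega,
      show j + r + 1 - (j + 1) = r by omega, h.η_succ k hl, h.ε_succ k hl]
    linear_combination (ε k r * η (k + 1) r * d j) * h.ab k
  · rw [Finset.sum_range_succ _ (N + 1)]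
    simp only [Nat.sub_self, h.η_zero]
    rw [if_neg (by omega : ¬ k < l), if_neg (by omega : ¬ k < l + 1), sub_self, add_zero]
    refine Finset.sum_congr rfl fun j hj => ?_
    obtain ⟨r, rfl⟩ : ∃ r, N = j + r := ⟨N - j, by simp at hj; omega⟩
    rw [if_neg hkl.ne', if_neg (by omega), if_neg (by omega), if_neg (by omega),
      show j + r + 1 - j = r + 1 by omega, show j + r - j = r by omega, h.η_succ l hl]
    ring

/-- For fixed `l'` the sum over `k'` telescopes to an odd coefficient; times `b_{l'}` this is again
a difference, so the sum over `l'` telescopes too. Each sum yields one factor `1 - q^(N+1)`. -/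
theorem RowData.evenCoeff_recurrence (h : RowData n q a b ε η d) (N k l : ℕ) (hk : k < n)
    (hl : l < n) :
    ∑ l' ∈ Finset.range n, ∑ k' ∈ Finset.range n,
        a k' * b l' * q ^ ((N + 1) * deltaNat (k', l') (k, l))
          * evenCoeff q ε η d N k' (if k' = l' then l' else l' + 1)
      = (1 - q ^ (N + 1)) ^ 2 * evenCoeff q ε η d (N + 1) k (if k = l then l else l + 1) := by
  have e1 : ∀ l' ∈ Finset.range n, ∑ k' ∈ Finset.range n,
        a k' * b l' * q ^ ((N + 1) * deltaNat (k', l') (k, l))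
          * evenCoeff q ε η d N k' (if k' = l' then l' else l' + 1)
      = (1 - q ^ (N + 1)) * ((q ^ (N + 1)) ^ (if l' < (if k = l then l else l + 1) then 1 else 0) *
        (evenCoeff q ε η d (N + 1) k l' - evenCoeff q ε η d (N + 1) k (l' + 1))) := by
    intro l' hl'
    have hl'' : l' < n := by simpa using hl'
    rw [← h.even_step N k l' hl'']
    have := sum_telescope_ge n (if k = l' then l' + 1 else k) (by split_ifs <;> omega)
      (q ^ (N + 1)) (oddCoeff q ε η d N l') (h.odd_scale N l' hl'')
    rw [show ∀ Q x y z : A, Q * (x * (y * z)) = (x * y) * (Q * z) by intros; ring, ← this,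
      Finset.mul_sum]
    refine Finset.sum_congr rfl fun k' hk' => ?_
    rw [← h.odd_step N k' l' (by simpa using hk')]
    -- `Δ` splits into an indicator that involves `l'` only and a threshold for `k'` that depends on
    -- `l'`.
    have hd : deltaNat (k', l') (k, l) = (if l' < (if k = l then l else l + 1) then 1 else 0)
        + (if (if k = l' then l' + 1 else k) ≤ k' then 1 else 0) := by
      unfold deltaNat
      simp only
      rw [add_comm]
      congr 1 <;> refine if_congr ?_ rfl rfl <;> split_ifs <;> omega
    rw [hd, mul_add, pow_add, pow_mul, pow_mul]
    ring
  rw [Finset.sum_congr rfl e1, ← Finset.mul_sum,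
    sum_telescope_lt n _ (by split_ifs <;> omega) _ _ (h.even_scale (N + 1) k hk)]
  ring

/-- A solution of the recurrence of generalised Primc partitions has a closed form. -/
theorem RowData.closed_form (h : RowData n q a b ε η d) (L : ℕ → ℕ → ℕ → A)
    (hu : ∀ N, IsUnit (1 - q ^ (N + 1))) (h0 : ∀ k l, L 0 k l = 1)
    (hL : ∀ N, ∀ k < n, ∀ l < n, (1 - q ^ (N + 1)) * L (N + 1) k l =
      ∑ l' ∈ Finset.range n, ∑ k' ∈ Finset.range n,
        a k' * b l' * q ^ ((N + 1) * deltaNat (k', l') (k, l)) * L N k' l')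
    (N k l : ℕ) (hk : k < n) (hl : l < n) :
    L N k l = (∏ j ∈ Finset.range N, (1 - q ^ (j + 1)))
      * evenCoeff q ε η d N k (if k = l then l else l + 1) := by
  induction N generalizing k l with
  | zero => simp [h0, evenCoeff, h.ε_zero, h.η_zero, h.d_zero]
  | succ N ih =>
    -- One of the two factors `1 - q^(N+1)` cancels against the left side, the other extends the
    -- product.
    refine (hu N).mul_left_cancel ?_
    rw [hL N k hk l hl, Finset.prod_range_succ]
    rw [show ∀ x y z : A, x * (y * x * z) = y * (x ^ 2 * z) by intros; ring,
      ← h.evenCoeff_recurrence N k l hk hl, Finset.mul_sum]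
    refine Finset.sum_congr rfl fun l' hl' => ?_
    rw [Finset.mul_sum]
    refine Finset.sum_congr rfl fun k' hk' => ?_
    rw [ih k' l' (by simpa using hk') (by simpa using hl')]
    ring

end

/-! ### Row series from Euler's expansion, and their truncations. -/

section Euler
open PowerSeries
variable {R : Type} [CommRing R]

/-- The power series `1 / (q; q)_j`. -/
noncomputable def invFact (R : Type) [CommRing R] : ℕ → PowerSeries R
  | 0 => 1
  | j + 1 => invFact R j * PowerSeries.invOfUnit (1 - X ^ (j + 1)) 1

theorem isUnit_one_sub_X_pow (j : ℕ) : IsUnit (1 - X ^ (j + 1) : PowerSeries R) := by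
  rw [PowerSeries.isUnit_iff_constantCoeff]
  simp

theorem invFact_succ (j : ℕ) : (1 - X ^ (j + 1)) * invFact R (j + 1) = invFact R j := by
  rw [invFact, mul_left_comm, PowerSeries.mul_invOfUnit _ 1 (by simp), mul_one]

/-- `(-x; q)_∞` as a power series in `x` over the power series in `q`, by Euler's expansion. -/
noncomputable def eulerSeries (R : Type) [CommRing R] : PowerSeries (PowerSeries R) :=
  PowerSeries.mk fun r => X ^ (r.choose 2) * invFact R r

/-- The functional equation `(-x; q)_∞ = (1 + x) (-xq; q)_∞`; on coefficients it reads `(1 -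
q^(r+1)) e_{r+1} = q^r e_r`. -/
theorem eulerSeries_eq : eulerSeries R = (1 + X) * rescale (X : PowerSeries R) (eulerSeries R) := by
  ext1 r
  rw [add_mul, one_mul, map_add, coeff_rescale]
  cases r with
  | zero => simp [eulerSeries]
  | succ r =>
    rw [coeff_succ_X_mul, coeff_rescale]
    simp only [eulerSeries, coeff_mk]
    rw [← invFact_succ r, Nat.choose_succ_succ' r 1, Nat.choose_one_right, pow_add]
    ring

theorem rescale_eulerSeries (c : PowerSeries R) :
    rescale c (eulerSeries R) = (1 + C c * X) * rescale (c * X) (eulerSeries R) := by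
  conv_lhs => rw [eulerSeries_eq]
  rw [map_mul, map_add, map_one, rescale_X, mul_comm c X, ← rescale_rescale]

theorem rescale_eulerSeries_truncate (c : PowerSeries R) (M : ℕ) :
    rescale c (eulerSeries R) = (∏ j ∈ Finset.range M, (1 + C (c * X ^ j) * X))
      * rescale (c * X ^ M) (eulerSeries R) := by
  induction M with
  | zero => simp
  | succ M ih =>
    rw [ih, Finset.prod_range_succ, rescale_eulerSeries (c * X ^ M), mul_assoc c, ← pow_succ]
    ring

theorem coeff_rescale_C_eulerSeries_zero (c : PowerSeries R) :
    constantCoeff (rescale c (eulerSeries R)) = 1 := by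
  rw [← coeff_zero_eq_constantCoeff_apply, coeff_rescale]
  simp [eulerSeries, invFact]

variable (n : ℕ) (a b : ℕ → R)

/-- `∏_{i < k} (-x a_i; q)_∞ ∏_{i ≥ k} (-x a_i q; q)_∞`. -/
noncomputable def upperSeries (k : ℕ) : PowerSeries (PowerSeries R) :=
  ∏ i ∈ Finset.range n, rescale (C (a i) * X ^ (if k ≤ i then 1 else 0)) (eulerSeries R)

/-- `∏_{i < m} (-x b_i q; q)_∞ ∏_{i ≥ m} (-x b_i; q)_∞`. -/
noncomputable def lowerSeries (m : ℕ) : PowerSeries (PowerSeries R) :=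
  ∏ i ∈ Finset.range n, rescale (C (b i) * X ^ (if i < m then 1 else 0)) (eulerSeries R)

theorem upperSeries_succ (k : ℕ) (hk : k < n) :
    upperSeries n a (k + 1) = (1 + C (C (a k)) * X) * upperSeries n a k := by
  have : (1 + C (C (a k)) * X : PowerSeries (PowerSeries R))
      = ∏ i ∈ Finset.range n, if k = i then 1 + C (C (a i)) * X else 1 := by
    rw [Finset.prod_ite_eq, if_pos (by simpa using hk)]
  rw [this, upperSeries, upperSeries, ← Finset.prod_mul_distrib]
  refine Finset.prod_congr rfl fun i _ => ?_
  rcases lt_trichotomy k i with h | rfl | h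
  · rw [if_pos (by omega), if_neg (by omega), if_pos (by omega), one_mul]
  · rw [if_neg (by omega), if_pos rfl, if_pos le_rfl, pow_zero, mul_one, pow_one,
      rescale_eulerSeries]
  · rw [if_neg (by omega), if_neg (by omega), if_neg (by omega), one_mul]

theorem lowerSeries_succ (k : ℕ) (hk : k < n) :
    lowerSeries n b k = (1 + C (C (b k)) * X) * lowerSeries n b (k + 1) := by
  have : (1 + C (C (b k)) * X : PowerSeries (PowerSeries R))
      = ∏ i ∈ Finset.range n, if k = i then 1 + C (C (b i)) * X else 1 := by
    rw [Finset.prod_ite_eq, if_pos (by simpa using hk)]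
  rw [this, lowerSeries, lowerSeries, ← Finset.prod_mul_distrib]
  refine Finset.prod_congr rfl fun i _ => ?_
  rcases lt_trichotomy k i with h | rfl | h
  · rw [if_neg (by omega), if_neg (by omega), if_neg (by omega), one_mul]
  · rw [if_neg (by omega), if_pos rfl, if_pos (by omega), pow_zero, mul_one, pow_one,
      rescale_eulerSeries]
  · rw [if_pos (by omega), if_neg (by omega), if_pos (by omega), one_mul]

theorem rescale_X_upperSeries :
    rescale (X : PowerSeries R) (upperSeries n a n) = upperSeries n a 0 := by
  rw [upperSeries, upperSeries, map_prod (rescale (X : PowerSeries R))]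
  refine Finset.prod_congr rfl fun i hi => ?_
  rw [rescale_rescale, if_neg (by simpa using hi), if_pos (Nat.zero_le _), pow_zero, mul_one,
    pow_one]

theorem rescale_X_lowerSeries :
    rescale (X : PowerSeries R) (lowerSeries n b 0) = lowerSeries n b n := by
  rw [lowerSeries, lowerSeries, map_prod (rescale (X : PowerSeries R))]
  refine Finset.prod_congr rfl fun i hi => ?_
  rw [rescale_rescale, if_neg (by omega), if_pos (by simpa using hi), pow_zero, mul_one,
    pow_one]

theorem rowData (hab : ∀ k, a k * b k = 1) :
    RowData n (X : PowerSeries R) (fun k => C (a k)) (fun k => C (b k))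
      (fun k r => coeff r (upperSeries n a k)) (fun m r => coeff r (lowerSeries n b m))
      (invFact R) where
  ab k := by rw [← map_mul, hab, map_one]
  ε_zero k := by
    simp only [coeff_zero_eq_constantCoeff_apply, upperSeries, map_prod,
      coeff_rescale_C_eulerSeries_zero, Finset.prod_const_one]
  η_zero k := by
    simp only [coeff_zero_eq_constantCoeff_apply, lowerSeries, map_prod,
      coeff_rescale_C_eulerSeries_zero, Finset.prod_const_one]
  ε_succ k hk r := by
    rw [upperSeries_succ n a k hk, add_mul, one_mul, map_add, mul_assoc, coeff_C_mul,
      coeff_succ_X_mul]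
  η_succ k hk r := by
    rw [lowerSeries_succ n b k hk, add_mul, one_mul, map_add, mul_assoc, coeff_C_mul,
      coeff_succ_X_mul]
  ε_scale r := by rw [← coeff_rescale, rescale_X_upperSeries]
  η_scale r := by rw [← coeff_rescale, rescale_X_lowerSeries]
  d_zero := rfl
  d_succ := invFact_succ

/-- In this row each `x` comes with at least one `q`, so only `r ≤ m` can contribute to the
coefficient of `q^m`. -/
theorem X_pow_dvd_coeff_upperSeries_zero (r : ℕ) :
    (X : PowerSeries R) ^ r ∣ coeff r (upperSeries n a 0) := by
  exact ⟨coeff r (upperSeries n a n), by rw [← coeff_rescale, rescale_X_upperSeries]⟩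

/-- The truncation `∏_i ∏_{j < M} (1 + c_i q^j x)`. -/
noncomputable def rowPoly (c : ℕ → PowerSeries R) (M : ℕ) : Polynomial (PowerSeries R) :=
  ∏ i ∈ Finset.range n, ∏ j ∈ Finset.range M,
    (1 + Polynomial.C (c i * X ^ j) * Polynomial.X)

/-- The discarded tails `(-c_i q^M x; q)_∞` are 1 modulo `q^M`. Truncations link the rows, which are
series in `x` over series in `q`, with the product of the theorem, a series in `q` over Laurent
polynomials in `x`. -/
theorem coeff_rowPoly (c : ℕ → PowerSeries R) (M r : ℕ) :
    X ^ M ∣ coeff r (∏ i ∈ Finset.range n, rescale (c i) (eulerSeries R))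
      - (rowPoly n c M).coeff r := by
  have h1 : ∏ i ∈ Finset.range n, rescale (c i) (eulerSeries R)
      = (rowPoly n c M : PowerSeries (PowerSeries R))
        * ∏ i ∈ Finset.range n, rescale (c i * X ^ M) (eulerSeries R) := by
    have h2 : (rowPoly n c M : PowerSeries (PowerSeries R))
        = ∏ i ∈ Finset.range n, ∏ j ∈ Finset.range M, (1 + C (c i * X ^ j) * X) := by
      change Polynomial.coeToPowerSeries.ringHom (rowPoly n c M) = _
      simp only [rowPoly, map_prod, map_add, map_one, map_mul]
      simp
    rw [h2, ← Finset.prod_mul_distrib]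
    exact Finset.prod_congr rfl fun i _ => rescale_eulerSeries_truncate _ _
  -- Congruences modulo `q^M` become equalities in the quotient ring, where products can be handled
  -- factor by factor.
  let π := Ideal.Quotient.mk (Ideal.span {(X : PowerSeries R) ^ M})
  have hπ : π (X ^ M) = 0 := Ideal.Quotient.eq_zero_iff_mem.mpr (Ideal.mem_span_singleton_self _)
  have h3 : PowerSeries.map π (∏ i ∈ Finset.range n, rescale (c i * X ^ M) (eulerSeries R)) = 1 := by
    rw [map_prod]
    refine Finset.prod_eq_one fun i _ => ?_
    ext s
    rw [coeff_map, coeff_rescale, coeff_one]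
    split_ifs with hs
    · subst hs; simp [eulerSeries, invFact]
    · rw [map_mul, map_pow, map_mul, hπ, mul_zero, zero_pow hs, zero_mul]
  rw [← Ideal.mem_span_singleton, ← Ideal.Quotient.mk_eq_mk_iff_sub_mem]
  change π _ = π _
  rw [← coeff_map, h1, map_mul, h3, mul_one, coeff_map, Polynomial.coeff_coe]

theorem sum_coeff_rowPoly (m : ℕ) :
    ∑ r ∈ Finset.range (m + 1),
        coeff m (coeff r (upperSeries n a 0) * coeff r (lowerSeries n b 0))
      = ∑ r ∈ Finset.range (m + 1), coeff m ((rowPoly n (fun i => C (a i) * X) (m + 1)).coeff r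
          * (rowPoly n (fun i => C (b i)) (m + 1)).coeff r) := by
  refine Finset.sum_congr rfl fun r _ => ?_
  have h1 := coeff_rowPoly n (fun i => C (a i) * X) (m + 1) r
  have h2 := coeff_rowPoly n (fun i => C (b i)) (m + 1) r
  have e1 : upperSeries n a 0 = ∏ i ∈ Finset.range n, rescale (C (a i) * X) (eulerSeries R) := by
    simp [upperSeries]
  have e2 : lowerSeries n b 0 = ∏ i ∈ Finset.range n, rescale (C (b i)) (eulerSeries R) := by
    simp [lowerSeries]
  rw [← e1] at h1
  rw [← e2] at h2
  rw [← sub_eq_zero, ← map_sub]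
  refine X_pow_dvd_iff.mp ?_ m (Nat.lt_succ_self m)
  convert dvd_add (h1.mul_right (coeff r (lowerSeries n b 0)))
    (h2.mul_left ((rowPoly n (fun i => C (a i) * X) (m + 1)).coeff r)) using 1
  ring

theorem X_pow_dvd_qPochhammer_sub (c : PowerSeries R) (M : ℕ) :
    X ^ M ∣ qPochhammer c - ∏ k ∈ Finset.range M, (1 - c * X ^ k) := by
  rw [X_pow_dvd_iff]
  intro m hm
  rw [map_sub, sub_eq_zero]
  let : TopologicalSpace R := ⊥
  have : DiscreteTopology R := ⟨rfl⟩
  let : TopologicalSpace (PowerSeries R) := PowerSeries.WithPiTopology.instTopologicalSpace R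
  have h := ((PowerSeries.WithPiTopology.continuous_coeff R m).tendsto _).comp
    (multipliable_qPochhammer c).hasProd.tendsto_prod_nat
  -- The coefficients lie in a discrete space, so convergence of the partial products means that
  -- each coefficient is eventually constant.
  rw [nhds_discrete, Filter.tendsto_pure] at h
  obtain ⟨N, hN⟩ := Filter.eventually_atTop.mp h
  have stab : ∀ K, M ≤ K → coeff m (∏ k ∈ Finset.range K, (1 - c * X ^ k))
      = coeff m (∏ k ∈ Finset.range M, (1 - c * X ^ k)) := by
    intro K hK
    induction K, hK using Nat.le_induction with
    | base => rfl
    | succ K hK ih =>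
      rw [Finset.prod_range_succ, mul_sub, mul_one, map_sub, ih, sub_eq_self, ← mul_assoc,
        coeff_mul_X_pow', if_neg (by omega)]
  rw [← stab (max M N) (le_max_left _ _)]
  exact (hN (max M N) (le_max_right _ _)).symm

end Euler

/-! ### The constant term in `x` of the product. -/

section FrobeniusProduct
open PowerSeries
variable {n : ℕ}

/-- The symbol `a_k`. -/
noncomputable def aSymb (n k : ℕ) : ColourRing n := monom fun i => if k = i then 1 else 0

/-- The symbol `b_k = a_k⁻¹`. -/
noncomputable def bSymb (n k : ℕ) : ColourRing n := monom fun i => if k = i then -1 else 0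

theorem monom_mul_monom (e f : Fin n → ℤ) : monom e * monom f = monom (e + f) := by
  simp [monom, AddMonoidAlgebra.single_mul_single]

theorem monom_zero : monom (0 : Fin n → ℤ) = 1 := rfl

theorem aSymb_mul_bSymb (k : ℕ) : aSymb n k * bSymb n k = 1 := by
  rw [aSymb, bSymb, monom_mul_monom, ← monom_zero]
  congr 1
  ext i
  simp only [Pi.add_apply, Pi.zero_apply]
  split_ifs <;> simp

theorem coeffX0_add (f g : PowerSeries (XRing n)) :
    coeffX0 (f + g) = coeffX0 f + coeffX0 g := by
  ext1 m
  simp [coeffX0]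

theorem coeffX0_sum {ι : Type*} (s : Finset ι) (f : ι → PowerSeries (XRing n)) :
    coeffX0 (∑ i ∈ s, f i) = ∑ i ∈ s, coeffX0 (f i) := by
  classical
  induction s using Finset.induction_on with
  | empty => ext1 m; simp [coeffX0]
  | insert i s hi ih => rw [Finset.sum_insert hi, Finset.sum_insert hi, coeffX0_add, ih]

theorem coeffX0_map_C_mul_T (p : PowerSeries (ColourRing n)) (k : ℤ) :
    coeffX0 (PowerSeries.map LaurentPolynomial.C p * C (LaurentPolynomial.T k))
      = if k = 0 then p else 0 := by
  ext1 m
  rw [coeffX0, coeff_mk, coeff_mul_C, coeff_map, ← LaurentPolynomial.single_eq_C_mul_T,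
    AddMonoidAlgebra.coeff_single, Finsupp.single_apply]
  split_ifs <;> simp

/-- Substitution of `x ^ k` for the variable, for `k = 1` or `k = -1`. -/
noncomputable def substT (k : ℤ) :
    Polynomial (PowerSeries (ColourRing n)) →+* PowerSeries (XRing n) :=
  Polynomial.eval₂RingHom (PowerSeries.map LaurentPolynomial.C) (C (LaurentPolynomial.T k))

theorem substT_eq_sum (k : ℤ) (P : Polynomial (PowerSeries (ColourRing n))) (D : ℕ)
    (hD : P.natDegree < D) :
    substT k P = ∑ r ∈ Finset.range D,
      PowerSeries.map LaurentPolynomial.C (P.coeff r) * C (LaurentPolynomial.T (r * k)) := by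
  change Polynomial.eval₂ _ _ P = _
  rw [Polynomial.eval₂_eq_sum_range' _ hD]
  refine Finset.sum_congr rfl fun r _ => ?_
  rw [← map_pow, LaurentPolynomial.T_pow]

/-- Only the diagonal terms `x^r x^(-r)` survive. -/
theorem coeffX0_substT_mul_substT (P Q : Polynomial (PowerSeries (ColourRing n))) (D : ℕ)
    (hP : P.natDegree < D) (hQ : Q.natDegree < D) :
    coeffX0 (substT 1 P * substT (-1) Q) = ∑ r ∈ Finset.range D, P.coeff r * Q.coeff r := by
  rw [substT_eq_sum 1 P D hP, substT_eq_sum (-1) Q D hQ, Finset.sum_mul_sum, coeffX0_sum]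
  refine Finset.sum_congr rfl fun r hr => ?_
  rw [coeffX0_sum, Finset.sum_eq_single_of_mem r hr]
  · rw [mul_mul_mul_comm, ← map_mul, ← map_mul, ← LaurentPolynomial.T_add, coeffX0_map_C_mul_T,
      if_pos (by ring)]
  · intro s _ hs
    rw [mul_mul_mul_comm, ← map_mul, ← map_mul, ← LaurentPolynomial.T_add, coeffX0_map_C_mul_T,
      if_neg (by omega)]

theorem qPochhammer_sub_substT (k : ℤ) (c : ColourRing n) (e M : ℕ) :
    X ^ M ∣ qPochhammer (-(C (LaurentPolynomial.T k * LaurentPolynomial.C c) * X ^ e))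
      - substT k (∏ j ∈ Finset.range M, (1 + Polynomial.C (C c * X ^ e * X ^ j) * Polynomial.X)) := by
  convert X_pow_dvd_qPochhammer_sub _ M using 2
  rw [map_prod]
  refine Finset.prod_congr rfl fun j _ => ?_
  rw [map_add, map_one, map_mul, substT]
  simp only [Polynomial.coe_eval₂RingHom, Polynomial.eval₂_C, Polynomial.eval₂_X, map_mul,
    map_pow, PowerSeries.map_X, PowerSeries.map_C]
  ring

theorem frobeniusProduct_sub_substT (M : ℕ) :
    X ^ M ∣ frobeniusProduct n - substT 1 (rowPoly n (fun i => C (aSymb n i) * X) M)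
      * substT (-1) (rowPoly n (fun i => C (bSymb n i)) M) := by
  have ha : ∀ i : Fin n, monom (Pi.single i 1) = aSymb n i := fun i => by
    unfold aSymb
    congr 1
    ext j
    simp [Pi.single_apply, Fin.ext_iff, eq_comm]
  have hb : ∀ i : Fin n, monom (Pi.single i (-1)) = bSymb n i := fun i => by
    unfold bSymb
    congr 1
    ext j
    simp [Pi.single_apply, Fin.ext_iff, eq_comm]
  let π := Ideal.Quotient.mk (Ideal.span {(X : PowerSeries (XRing n)) ^ M})
  have hπ : ∀ f g, X ^ M ∣ f - g ↔ π f = π g := fun f g => by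
    rw [← Ideal.mem_span_singleton, ← Ideal.Quotient.mk_eq_mk_iff_sub_mem]
  rw [hπ, frobeniusProduct, rowPoly, rowPoly, Finset.prod_range, Finset.prod_range, map_prod,
    map_prod, map_prod, ← Finset.prod_mul_distrib, map_prod]
  refine Finset.prod_congr rfl fun i _ => ?_
  have h1 := (hπ _ _).mp (qPochhammer_sub_substT 1 (aSymb n i) 1 M)
  have h2 := (hπ _ _).mp (qPochhammer_sub_substT (-1) (bSymb n i) 0 M)
  rw [ha, hb, π.map_mul, π.map_mul]
  simp only [pow_one, pow_zero, mul_one] at h1 h2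
  rw [h1, h2]

theorem X_pow_dvd_coeff_rowPoly (a : ℕ → ColourRing n) (m r : ℕ) (hr : m < r) :
    coeff m ((rowPoly n (fun i => C (a i) * X) (m + 1)).coeff r
      * (rowPoly n (fun i => C (bSymb n i)) (m + 1)).coeff r) = 0 := by
  have h1 := coeff_rowPoly n (fun i => C (a i) * X) (m + 1) r
  have h2 := X_pow_dvd_coeff_upperSeries_zero n a r
  rw [show upperSeries n a 0 = ∏ i ∈ Finset.range n, rescale (C (a i) * X)
    (eulerSeries (ColourRing n)) by simp [upperSeries]] at h2
  have h3 := (dvd_sub_right ((pow_dvd_pow X hr).trans h2)).mp h1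
  exact X_pow_dvd_iff.mp (h3.mul_right _) m (Nat.lt_succ_self m)

theorem coeff_coeffX0_frobeniusProduct (m : ℕ) :
    coeff m (coeffX0 (frobeniusProduct n)) = ∑ r ∈ Finset.range (m + 1),
      coeff m ((rowPoly n (fun i => C (aSymb n i) * X) (m + 1)).coeff r
        * (rowPoly n (fun i => C (bSymb n i)) (m + 1)).coeff r) := by
  have h1 : coeff m (coeffX0 (frobeniusProduct n))
      = coeff m (coeffX0 (substT 1 (rowPoly n (fun i => C (aSymb n i) * X) (m + 1))
      * substT (-1) (rowPoly n (fun i => C (bSymb n i)) (m + 1)))) := by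
    have h := X_pow_dvd_iff.mp (frobeniusProduct_sub_substT (n := n) (m + 1)) m
      (Nat.lt_succ_self m)
    rw [map_sub, sub_eq_zero] at h
    rw [coeffX0, coeffX0, coeff_mk, coeff_mk, h]
  set P := rowPoly n (fun i => C (aSymb n i) * X) (m + 1) with hP
  set Q := rowPoly n (fun i => C (bSymb n i)) (m + 1) with hQ
  -- The bound exceeds both degrees; the extra terms, with `r > m`, do not reach `q^m`.
  rw [h1, coeffX0_substT_mul_substT P Q (max (m + 1) (max P.natDegree Q.natDegree + 1))
    (by omega) (by omega), map_sum]
  symm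
  refine Finset.sum_subset (Finset.range_subset_range.mpr (le_max_left _ _)) fun r _ hr => ?_
  exact X_pow_dvd_coeff_rowPoly (aSymb n) m r (by simpa using hr)

end FrobeniusProduct

/-! ### Generating functions of sets of coloured lists. -/

section GeneratingFunction
open PowerSeries
variable {n : ℕ}

/-- The total size of a list of parts. -/
def listSize (l : List Part) : ℕ := (l.map Part.size).sum

/-- The product of the colours of a list of parts. -/
noncomputable def listWeight (n : ℕ) (l : List Part) : ColourRing n :=
  (l.map fun x => aSymb n x.colour.1 * bSymb n x.colour.2).prod

/-- The lists of total size `m` in a set of lists of parts. -/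
def sizeFiber (S : Set (List Part)) (m : ℕ) : Set (List Part) := {l | l ∈ S ∧ listSize l = m}

/-- The generating function of a set of lists of parts. -/
noncomputable def listSeries (n : ℕ) (S : Set (List Part)) : PowerSeries (ColourRing n) :=
  PowerSeries.mk fun m => ∑ᶠ l ∈ sizeFiber S m, listWeight n l

/-- Finiteness of the fibres is essential: a `finsum` with infinite support is 0 by convention. -/
theorem listSeries_union {S T : Set (List Part)} (hS : ∀ m, (sizeFiber S m).Finite)
    (hT : ∀ m, (sizeFiber T m).Finite) (h : Disjoint S T) :
    listSeries n (S ∪ T) = listSeries n S + listSeries n T := by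
  ext1 m
  rw [map_add, listSeries, listSeries, listSeries, coeff_mk, coeff_mk, coeff_mk,
    ← finsum_mem_union _ (hS m) (hT m)]
  · refine finsum_mem_congr (Set.ext fun l => ?_) fun _ _ => rfl
    simp only [sizeFiber, Set.mem_union, Set.mem_ofPred_eq]
    tauto
  · exact h.mono (fun _ hl => hl.1) (fun _ hl => hl.1)

theorem finite_sizeFiber_mono {S T : Set (List Part)} (h : S ⊆ T)
    (hT : ∀ m, (sizeFiber T m).Finite) (m : ℕ) : (sizeFiber S m).Finite :=
  (hT m).subset fun _ hl => ⟨h hl.1, hl.2⟩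

theorem listSeries_biUnion {ι : Type*} (s : Finset ι) (S : ι → Set (List Part))
    (hS : ∀ m, (sizeFiber (⋃ i ∈ s, S i) m).Finite)
    (h : ∀ i ∈ s, ∀ j ∈ s, i ≠ j → Disjoint (S i) (S j)) :
    listSeries n (⋃ i ∈ s, S i) = ∑ i ∈ s, listSeries n (S i) := by
  classical
  induction s using Finset.induction_on with
  | empty =>
    ext1 m
    simp [listSeries, sizeFiber]
  | insert i s hi ih =>
    rw [Finset.sum_insert hi]
    rw [Finset.set_biUnion_insert] at hS ⊢
    have h1 := finite_sizeFiber_mono (Set.subset_union_left) hS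
    have h2 := finite_sizeFiber_mono (Set.subset_union_right) hS
    rw [listSeries_union h1 h2, ih h2]
    · exact fun j hj k hk => h j (Finset.mem_insert_of_mem hj) k (Finset.mem_insert_of_mem hk)
    · rw [Set.disjoint_iUnion₂_right]
      exact fun j hj => h i (Finset.mem_insert_self _ _) j (Finset.mem_insert_of_mem hj)
        (by rintro rfl; exact hi hj)

theorem listSeries_image {S : Set (List Part)} (f : List Part → List Part) (c : ColourRing n)
    (e : ℕ) (hS : ∀ m, (sizeFiber S m).Finite) (hf : Set.InjOn f S)
    (hsize : ∀ l ∈ S, listSize (f l) = listSize l + e)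
    (hwt : ∀ l ∈ S, listWeight n (f l) = c * listWeight n l) :
    listSeries n (f '' S) = C c * X ^ e * listSeries n S := by
  ext1 m
  rw [mul_assoc, coeff_C_mul, coeff_X_pow_mul', listSeries, listSeries, coeff_mk, coeff_mk]
  split_ifs with hm
  · have : sizeFiber (f '' S) m = f '' sizeFiber S (m - e) := by
      ext l
      simp only [sizeFiber, Set.mem_ofPred_eq, Set.mem_image]
      constructor
      · rintro ⟨⟨l, hl, rfl⟩, h⟩
        exact ⟨l, ⟨hl, by rw [hsize l hl] at h; omega⟩, rfl⟩
      · rintro ⟨l, ⟨hl, h⟩, rfl⟩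
        exact ⟨⟨l, hl, rfl⟩, by rw [hsize l hl]; omega⟩
    rw [this, finsum_mem_image (hf.mono fun _ h => h.1), mul_finsum_mem' _ _ (hS _)]
    exact finsum_mem_congr rfl fun l hl => hwt l hl.1
  · have : sizeFiber (f '' S) m = ∅ := by
      ext l
      simp only [sizeFiber, Set.mem_ofPred_eq, Set.mem_image, Set.mem_empty_iff_false, iff_false]
      rintro ⟨⟨l, hl, rfl⟩, h⟩
      rw [hsize l hl] at h
      omega
    rw [this, finsum_mem_empty, mul_zero]

theorem listSeries_singleton_nil : listSeries n {[]} = 1 := by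
  ext1 m
  rw [listSeries, coeff_mk, coeff_one]
  split_ifs with h
  · have : sizeFiber {[]} m = {[]} := by
      ext l
      simp only [sizeFiber, Set.mem_singleton_iff, Set.mem_ofPred_eq, and_iff_left_iff_imp]
      rintro rfl
      exact h.symm
    rw [this, finsum_mem_singleton]
    simp [listWeight]
  · have : sizeFiber {[]} m = ∅ := by
      ext l
      simp only [sizeFiber, Set.mem_singleton_iff, Set.mem_ofPred_eq, Set.mem_empty_iff_false,
        iff_false]
      rintro ⟨rfl, h'⟩
      exact h h'.symm
    rw [this, finsum_mem_empty]

theorem finite_sizeFiber_of_length {S : Set (List Part)} (K : ℕ → ℕ)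
    (hc : ∀ l ∈ S, ∀ x ∈ l, x.colour.1 < n ∧ x.colour.2 < n)
    (hK : ∀ l ∈ S, l.length ≤ K (listSize l)) (m : ℕ) : (sizeFiber S m).Finite := by
  have hs : {x : Part | x.size ≤ m ∧ x.colour.1 < n ∧ x.colour.2 < n}.Finite := by
    refine (((Set.finite_Iic m).prod ((Set.finite_Iio n).prod (Set.finite_Iio n))).image
      fun t : ℕ × ℕ × ℕ => (⟨t.1, t.2⟩ : Part)).subset ?_
    rintro ⟨p, k, l⟩ h
    exact ⟨(p, k, l), by simpa using h, rfl⟩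
  refine (finite_lists hs (K m)).subset ?_
  rintro l ⟨h, rfl⟩
  exact ⟨hK l h, fun x hx => ⟨List.le_sum_of_mem (List.mem_map_of_mem hx), hc l h x hx⟩⟩

end GeneratingFunction

/-! ### The generalisation of Primc's identity. -/

section Primc
open PowerSeries
variable {n : ℕ}

/-- The difference condition for consecutive parts, from right to left. -/
def StepUp (x y : Part) : Prop := x.size + deltaNat y.colour x.colour ≤ y.size

/-- Add `p` to all the parts. -/
def shiftParts (p : ℕ) (l : List Part) : List Part := l.map fun x => ⟨x.size + p, x.colour⟩

/-- The sequences of `N` parts, from right to left, that satisfy the difference conditions when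
a part `0_c` is added at the end. -/
def chainSet (n N : ℕ) (c : Colour) : Set (List Part) :=
  {l | l.length = N ∧ (∀ x ∈ l, x.colour.1 < n ∧ x.colour.2 < n) ∧
    (⟨0, c⟩ :: l).IsChain StepUp}

theorem listSize_shiftParts (p : ℕ) (l : List Part) :
    listSize (shiftParts p l) = listSize l + l.length * p := by
  induction l with
  | nil => simp [listSize, shiftParts]
  | cons x l ih =>
    simp only [listSize, shiftParts, List.map_cons, List.sum_cons, List.length_cons] at ih ⊢
    rw [ih]; ring

theorem listWeight_shiftParts (p : ℕ) (l : List Part) :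
    listWeight n (shiftParts p l) = listWeight n l := by
  simp [listWeight, shiftParts, Function.comp_def]

theorem shiftParts_injective (p : ℕ) : Function.Injective (shiftParts p) := by
  refine List.map_injective_iff.mpr ?_
  rintro ⟨s, c⟩ ⟨t, d⟩ h
  simpa using h

theorem isChain_cons_shiftParts (p : ℕ) (c : Colour) (l : List Part) :
    (⟨p, c⟩ :: shiftParts p l).IsChain StepUp ↔ (⟨0, c⟩ :: l).IsChain StepUp := by
  have : (⟨p, c⟩ :: shiftParts p l) = (⟨0, c⟩ :: l).map fun x : Part => ⟨x.size + p, x.colour⟩ := by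
    simp [shiftParts]
  rw [this, List.isChain_map]
  exact List.IsChain.iff fun x y => by unfold StepUp; simp only; omega

/-- Once the smallest part `p` is subtracted from the other parts, they form a chain above `0_{c'}`;
this self-similarity produces the recurrence. -/
theorem mem_chainSet_cons {N p : ℕ} {c c' : Colour} {l : List Part} :
    ⟨p, c'⟩ :: shiftParts p l ∈ chainSet n (N + 1) c ↔
      (c'.1 < n ∧ c'.2 < n) ∧ deltaNat c' c ≤ p ∧ l ∈ chainSet n N c' := by
  unfold chainSet
  simp only [Set.mem_ofPred_eq, List.length_cons, add_left_inj, List.mem_cons, forall_eq_or_imp,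
    List.isChain_cons_cons, isChain_cons_shiftParts]
  simp only [shiftParts, List.length_map, List.mem_map, forall_exists_index, and_imp,
    forall_apply_eq_imp_iff₂, StepUp, zero_add]
  tauto

/-- Sizes increase weakly along the chain, so the truncated subtraction of the first size is exact.
-/
theorem exists_eq_cons_shiftParts {N : ℕ} {c : Colour} {l : List Part}
    (h : l ∈ chainSet n (N + 1) c) : ∃ p c' l', l = ⟨p, c'⟩ :: shiftParts p l' := by
  obtain ⟨h1, -, h3⟩ := h
  match l, h1, h3 with
  | ⟨p, c'⟩ :: t, _, h3 =>
    refine ⟨p, c', t.map fun x => ⟨x.size - p, x.colour⟩, ?_⟩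
    rw [shiftParts, List.map_map, List.cons.injEq]
    refine ⟨rfl, ?_⟩
    symm
    have h4 : (⟨p, c'⟩ :: t : List Part).IsChain fun x y => x.size ≤ y.size :=
      (List.isChain_cons_cons.mp h3).2.imp fun x y h => by unfold StepUp at h; omega
    have : IsTrans Part fun x y => x.size ≤ y.size := ⟨fun _ _ _ => le_trans⟩
    have h5 : ∀ x ∈ t, p ≤ x.size := fun x hx => List.rel_of_pairwise_cons h4.pairwise hx
    conv_rhs => rw [← List.map_id t]
    refine List.map_congr_left fun x hx => ?_
    have := h5 _ hx
    obtain ⟨s, d⟩ := x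
    simp only at this
    simp only [Function.comp_apply, id_eq, Part.mk.injEq, and_true]
    omega

theorem finite_chainSet (N : ℕ) (c : Colour) (m : ℕ) : (sizeFiber (chainSet n N c) m).Finite :=
  finite_sizeFiber_of_length (n := n) (fun _ => N) (fun _ hl => hl.2.1) (fun _ hl => hl.1.le) m

/-- Either the smallest part has the least size that its colour permits, or all `N + 1` parts can be
lowered by 1. The second alternative is the source of the factor `1 - q^(N+1)`. -/
theorem chainSet_succ (N : ℕ) (c : Colour) :
    chainSet n (N + 1) c = (⋃ c' ∈ Finset.range n ×ˢ Finset.range n,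
      (fun l => ⟨deltaNat c' c, c'⟩ :: shiftParts (deltaNat c' c) l) '' chainSet n N c')
      ∪ shiftParts 1 '' chainSet n (N + 1) c := by
  have key : ∀ p c' (t : List Part),
      shiftParts 1 (⟨p, c'⟩ :: shiftParts p t) = ⟨p + 1, c'⟩ :: shiftParts (p + 1) t := by
    intro p c' t
    simp [shiftParts, Function.comp_def, add_assoc]
  ext l
  simp only [Set.mem_union, Set.mem_iUnion, Set.mem_image, Finset.mem_product, Finset.mem_range]
  constructor
  · intro h
    obtain ⟨p, c', l, rfl⟩ := exists_eq_cons_shiftParts h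
    rw [mem_chainSet_cons] at h
    obtain ⟨h1, h2, h3⟩ := h
    rcases h2.eq_or_lt with h2 | h2
    · subst h2
      exact Or.inl ⟨c', h1, l, h3, rfl⟩
    · refine Or.inr ⟨⟨p - 1, c'⟩ :: shiftParts (p - 1) l, ?_, ?_⟩
      · rw [mem_chainSet_cons]
        exact ⟨h1, by omega, h3⟩
      · rw [key, Nat.sub_add_cancel (by omega)]
  · rintro (⟨c', h1, l, h2, rfl⟩ | ⟨l, h, rfl⟩)
    · exact mem_chainSet_cons.mpr ⟨h1, le_rfl, h2⟩
    · obtain ⟨p, c', l, rfl⟩ := exists_eq_cons_shiftParts h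
      rw [mem_chainSet_cons] at h
      rw [key, mem_chainSet_cons]
      exact ⟨h.1, by omega, h.2.2⟩

theorem listWeight_cons (x : Part) (l : List Part) :
    listWeight n (x :: l) = aSymb n x.colour.1 * bSymb n x.colour.2 * listWeight n l := by
  simp [listWeight]

theorem listSeries_chainSet_succ (N k l : ℕ) :
    (1 - X ^ (N + 1)) * listSeries n (chainSet n (N + 1) (k, l)) =
      ∑ l' ∈ Finset.range n, ∑ k' ∈ Finset.range n, C (aSymb n k') * C (bSymb n l')
        * X ^ ((N + 1) * deltaNat (k', l') (k, l)) * listSeries n (chainSet n N (k', l')) := by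
  have hfin : ∀ m, (sizeFiber (chainSet n (N + 1) (k, l)) m).Finite := finite_chainSet _ _
  have hfin' := hfin
  rw [chainSet_succ] at hfin'
  have h := congrArg (listSeries n) (chainSet_succ (n := n) N (k, l))
  rw [listSeries_union (finite_sizeFiber_mono Set.subset_union_left hfin')
    (finite_sizeFiber_mono Set.subset_union_right hfin'),
    listSeries_biUnion _ _ (finite_sizeFiber_mono Set.subset_union_left hfin'),
    listSeries_image (n := n) (S := chainSet n (N + 1) (k, l)) (shiftParts 1) 1 (N + 1) hfin
      (shiftParts_injective 1).injOn, map_one, one_mul, ← sub_eq_iff_eq_add] at h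
  · rw [sub_mul, one_mul, h, Finset.sum_product_right]
    refine Finset.sum_congr rfl fun l' _ => Finset.sum_congr rfl fun k' _ => ?_
    rw [listSeries_image (n := n) (S := chainSet n N (k', l')) _ (aSymb n k' * bSymb n l')
      ((N + 1) * deltaNat (k', l') (k, l)) (finite_chainSet _ _), map_mul]
    · intro s _ t _ hst
      exact shiftParts_injective _ (List.cons.inj hst).2
    · intro s hs
      have := listSize_shiftParts (deltaNat (k', l') (k, l)) s
      rw [hs.1] at this
      simp only [listSize, List.map_cons, List.sum_cons] at this ⊢
      rw [this]; ring
    · intro s _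
      rw [listWeight_cons, listWeight_shiftParts]
  · intro s hs
    rw [listSize_shiftParts, hs.1, mul_one]
  · intro s _
    rw [listWeight_shiftParts, one_mul]
  · intro c _ d _ hcd
    rw [Set.disjoint_left]
    rintro _ ⟨s, _, rfl⟩ ⟨t, _, ht⟩
    exact hcd (Part.mk.inj (List.cons.inj ht).1).2.symm
  · rw [Set.disjoint_left]
    intro s hs ht
    simp only [Set.mem_iUnion, Set.mem_image] at hs ht
    obtain ⟨c, _, s, _, rfl⟩ := hs
    obtain ⟨t, ht, heq⟩ := ht
    obtain ⟨p, c', t, rfl⟩ := exists_eq_cons_shiftParts ht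
    rw [mem_chainSet_cons] at ht
    have := (List.cons.inj heq).1
    simp only [Part.mk.injEq] at this
    obtain ⟨h1, rfl⟩ := this
    omega

/-- Generalised Primc partitions, written from right to left, of length at most `N`. -/
def primcRev (n N : ℕ) : Set (List Part) := {l | IsPrimc n l.reverse ∧ l.length ≤ N}

theorem isPrimc_reverse_iff {l : List Part} : IsPrimc n l.reverse ↔
    (∀ x ∈ l, 1 ≤ x.size) ∧ (∀ x ∈ l, x.colour.1 < n ∧ x.colour.2 < n) ∧ l.IsChain StepUp := by
  have h : l.reverse.IsChain (fun x y => Delta x.colour y.colour ≤ (x.size : ℤ) - (y.size : ℤ))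
      ↔ l.IsChain StepUp := by
    rw [List.isChain_reverse]
    refine List.IsChain.iff fun x y => ?_
    unfold StepUp
    rw [← coe_deltaNat]
    omega
  constructor
  · rintro ⟨h1, h2, h3⟩
    exact ⟨by simpa using h1, by simpa using h2, h.mp h3⟩
  · rintro ⟨h1, h2, h3⟩
    exact ⟨by simpa using h1, by simpa using h2, h.mpr h3⟩

theorem deltaNat_zero_eq_zero {c : Colour} (h : deltaNat c (0, 0) = 0) : c = (0, 0) := by
  obtain ⟨k, l⟩ := c
  unfold deltaNat at h
  simp only at h
  split_ifs at h <;> simp_all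

theorem deltaNat_zero_le_one (c : Colour) : deltaNat c (0, 0) ≤ 1 := by
  obtain ⟨k, l⟩ := c
  unfold deltaNat
  simp only
  split_ifs <;> simp_all

theorem finite_primcRev (N m : ℕ) : (sizeFiber (primcRev n N) m).Finite :=
  finite_sizeFiber_of_length (n := n) (fun _ => N) (fun _ hl => (isPrimc_reverse_iff.mp hl.1).2.1)
    (fun _ hl => hl.2) m

/-- `Δ(c, a_0 b_0)` is 0 for `c = a_0 b_0` and 1 for every other `c`: a smallest part of size 0 is
`0_{a_0 b_0}`, and positive parts satisfy the end condition automatically. -/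
theorem chainSet_zero_succ (hn : 0 < n) (N : ℕ) :
    chainSet n (N + 1) (0, 0) = (fun l => ⟨0, (0, 0)⟩ :: l) '' chainSet n N (0, 0)
      ∪ {l | IsPrimc n l.reverse ∧ l.length = N + 1} := by
  ext l
  simp only [Set.mem_union, Set.mem_image, Set.mem_ofPred_eq, isPrimc_reverse_iff]
  constructor
  · rintro ⟨h1, h2, h3⟩
    match l, h1, h2, h3 with
    | ⟨p, c⟩ :: t, h1, h2, h3 =>
      have h4 := List.isChain_cons_cons.mp h3
      have h5 : deltaNat c (0, 0) ≤ p := by simpa [StepUp] using h4.1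
      rcases Nat.eq_zero_or_pos p with rfl | hp
      · obtain rfl := deltaNat_zero_eq_zero (Nat.le_zero.mp h5)
        refine Or.inl ⟨t, ⟨by simpa using h1, fun x hx => h2 x (List.mem_cons_of_mem _ hx), h4.2⟩,
          rfl⟩
      · refine Or.inr ⟨⟨?_, h2, h4.2⟩, h1⟩
        have h6 : (⟨p, c⟩ :: t : List Part).IsChain fun x y => x.size ≤ y.size :=
          h4.2.imp fun x y h => by unfold StepUp at h; omega
        have : IsTrans Part fun x y => x.size ≤ y.size := ⟨fun _ _ _ => le_trans⟩
        intro x hx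
        rcases List.mem_cons.mp hx with rfl | hx
        · exact hp
        · exact le_trans hp (List.rel_of_pairwise_cons h6.pairwise hx)
  · rintro (⟨t, ⟨h1, h2, h3⟩, rfl⟩ | ⟨⟨h1, h2, h3⟩, h4⟩)
    · refine ⟨by simpa using h1, ?_, ?_⟩
      · intro x hx
        rcases List.mem_cons.mp hx with rfl | hx
        · exact ⟨hn, hn⟩
        · exact h2 x hx
      · exact List.isChain_cons_cons.mpr ⟨by simp [StepUp, deltaNat], h3⟩
    · refine ⟨h4, h2, ?_⟩
      match l, h1, h3 with
      | [], _, _ => simp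
      | x :: t, h1, h3 =>
        refine List.isChain_cons_cons.mpr ⟨?_, h3⟩
        have := h1 x (List.mem_cons_self)
        have := deltaNat_zero_le_one x.colour
        unfold StepUp
        simp only
        omega

/-- Copies of `0_{a_0 b_0}`, of size 0 and weight 1, pad a shorter partition to exactly `N` parts.
-/
theorem listSeries_primcRev (hn : 0 < n) (N : ℕ) :
    listSeries n (primcRev n N) = listSeries n (chainSet n N (0, 0)) := by
  induction N with
  | zero =>
    congr 1
    ext l
    simp only [primcRev, chainSet, Set.mem_ofPred_eq, Nat.le_zero, List.length_eq_zero_iff,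
      isPrimc_reverse_iff]
    constructor
    · rintro ⟨-, rfl⟩
      simp
    · rintro ⟨rfl, -⟩
      simp
  | succ N ih =>
    have h1 : primcRev n (N + 1) = primcRev n N ∪ {l | IsPrimc n l.reverse ∧ l.length = N + 1} := by
      ext l
      simp only [primcRev, Set.mem_union, Set.mem_ofPred_eq, ← and_or_left, Nat.le_succ_iff]
    have hfin : ∀ m, (sizeFiber {l | IsPrimc n l.reverse ∧ l.length = N + 1} m).Finite :=
      finite_sizeFiber_mono (T := primcRev n (N + 1)) (fun l hl => ⟨hl.1, hl.2.le⟩)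
        (finite_primcRev (N + 1))
    have hfin' := finite_chainSet (n := n) (N + 1) (0, 0)
    rw [chainSet_zero_succ hn] at hfin'
    rw [h1, listSeries_union (finite_primcRev N) hfin, chainSet_zero_succ hn,
      listSeries_union (finite_sizeFiber_mono Set.subset_union_left hfin') hfin, ih,
      listSeries_image (n := n) _ 1 0 (finite_chainSet N (0, 0)), map_one, pow_zero, one_mul,
      one_mul]
    · exact fun _ _ _ _ h => (List.cons.inj h).2
    · intro l _
      simp [listSize]
    · intro l _
      rw [listWeight_cons, aSymb_mul_bSymb]
    · rw [Set.disjoint_left]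
      rintro _ ⟨t, _, rfl⟩ ⟨h, _⟩
      have := (isPrimc_reverse_iff.mp h).1 _ List.mem_cons_self
      simp at this
    · rw [Set.disjoint_left]
      rintro l ⟨_, h⟩ ⟨_, h'⟩
      omega

theorem IsPrimc.length_le {l : List Part} (h : IsPrimc n l) : l.length ≤ listSize l := by
  have := List.card_nsmul_le_sum (l.map Part.size) 1 (by simpa using h.size_pos)
  simpa [listSize] using this

theorem finite_isPrimc (m : ℕ) : (sizeFiber {l | IsPrimc n l} m).Finite :=
  finite_sizeFiber_of_length (n := n) id (fun _ hl => hl.colour_lt) (fun _ hl => hl.length_le) m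

theorem listSize_reverse (l : List Part) : listSize l.reverse = listSize l := by
  simp [listSize, List.sum_reverse]

theorem listWeight_reverse (l : List Part) : listWeight n l.reverse = listWeight n l := by
  simp [listWeight, List.prod_reverse]

theorem coeff_listSeries_isPrimc {m N : ℕ} (hN : m ≤ N) :
    coeff m (listSeries n {l | IsPrimc n l}) = coeff m (listSeries n (primcRev n N)) := by
  rw [listSeries, listSeries, coeff_mk, coeff_mk]
  have : sizeFiber {l | IsPrimc n l} m = List.reverse '' sizeFiber (primcRev n N) m := by
    ext l
    simp only [sizeFiber, primcRev, Set.mem_ofPred_eq, Set.mem_image]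
    constructor
    · rintro ⟨h1, h2⟩
      refine ⟨l.reverse, ⟨⟨by simpa using h1, ?_⟩, by rw [listSize_reverse, h2]⟩, by simp⟩
      have := h1.length_le
      rw [List.length_reverse]
      omega
    · rintro ⟨l, ⟨⟨h1, -⟩, h2⟩, rfl⟩
      exact ⟨h1, by rw [listSize_reverse, h2]⟩
  rw [this, finsum_mem_image List.reverse_injective.injOn]
  exact finsum_mem_congr rfl fun l _ => listWeight_reverse l

theorem listSeries_chainSet_zero (c : Colour) : listSeries n (chainSet n 0 c) = 1 := by
  rw [← listSeries_singleton_nil]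
  congr 1
  ext l
  simp only [chainSet, Set.mem_ofPred_eq, List.length_eq_zero_iff, Set.mem_singleton_iff,
    and_iff_left_iff_imp]
  rintro rfl
  simp

theorem listSeries_chainSet (hn : 0 < n) (N : ℕ) :
    listSeries n (chainSet n N (0, 0)) = ∑ r ∈ Finset.range (N + 1),
      coeff r (upperSeries n (aSymb n) 0) * coeff r (lowerSeries n (bSymb n) 0)
        * ((∏ j ∈ Finset.range N, (1 - X ^ (j + 1))) * invFact (ColourRing n) (N - r)) := by
  have h := (rowData n (aSymb n) (bSymb n) aSymb_mul_bSymb).closed_form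
    (fun N k l => listSeries n (chainSet n N (k, l))) isUnit_one_sub_X_pow
    (fun k l => listSeries_chainSet_zero _) (fun N k _ l _ => listSeries_chainSet_succ N k l)
    N 0 0 hn hn
  rw [h, if_pos rfl, evenCoeff, ← Finset.sum_range_reflect, Finset.mul_sum]
  refine Finset.sum_congr rfl fun r hr => ?_
  have hr' : r ≤ N := by simp at hr; omega
  rw [show N - (N + 1 - 1 - r) = r by omega, show N + 1 - 1 - r = N - r by omega]
  simp only [lt_irrefl, if_false, one_mul]
  ring

theorem prod_mul_invFact {R : Type} [CommRing R] (M : ℕ) :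
    (∏ j ∈ Finset.range M, (1 - X ^ (j + 1))) * invFact R M = 1 := by
  induction M with
  | zero => simp [invFact]
  | succ M ih => rw [Finset.prod_range_succ, mul_assoc, invFact_succ, ih]

/-- The quotient `(q; q)_{M+s} / (q; q)_M` is a product of factors `1 - q^j` with `j > M`. -/
theorem X_pow_dvd_prod_mul_invFact_sub_one {R : Type} [CommRing R] (M s : ℕ) :
    (X : PowerSeries R) ^ (M + 1) ∣
      (∏ j ∈ Finset.range (M + s), (1 - X ^ (j + 1))) * invFact R M - 1 := by
  induction s with
  | zero => rw [add_zero, prod_mul_invFact, sub_self]; exact dvd_zero _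
  | succ s ih =>
    rw [← add_assoc, Finset.prod_range_succ]
    convert dvd_sub ih (((pow_dvd_pow X (by omega : M + 1 ≤ M + s + 1)).mul_left
      ((∏ j ∈ Finset.range (M + s), (1 - X ^ (j + 1))) * invFact R M))) using 1
    ring

theorem coeff_listSeries_isPrimc_eq_sum (hn : 0 < n) (m : ℕ) :
    coeff m (listSeries n {l | IsPrimc n l}) = ∑ r ∈ Finset.range (m + 1),
      coeff m (coeff r (upperSeries n (aSymb n) 0) * coeff r (lowerSeries n (bSymb n) 0)) := by
  -- With `N = 2m` one has `N - r ≥ m` for all `r ≤ m`, so `(q; q)_N / (q; q)_{N-r}` is 1 up to and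
  -- including degree `m`.
  rw [coeff_listSeries_isPrimc (N := m + m) (by omega), listSeries_primcRev hn,
    listSeries_chainSet hn, map_sum]
  rw [← Finset.sum_subset (Finset.range_subset_range.mpr (by omega : m + 1 ≤ m + m + 1))]
  · refine Finset.sum_congr rfl fun r hr => ?_
    have hr' : r ≤ m := by simp at hr; omega
    rw [← sub_eq_zero, ← map_sub, ← mul_sub_one]
    have h := X_pow_dvd_prod_mul_invFact_sub_one (R := ColourRing n) (m + m - r) r
    rw [Nat.sub_add_cancel (by omega)] at h
    exact X_pow_dvd_iff.mp (h.mul_left _) m (by omega)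
  · intro r _ hr
    have h := X_pow_dvd_coeff_upperSeries_zero n (aSymb n) r
    exact X_pow_dvd_iff.mp ((h.mul_right _).mul_right _) m (by simp at hr; omega)

/-- The generalisation of Primc's identity. -/
theorem listSeries_isPrimc (hn : 0 < n) :
    listSeries n {l | IsPrimc n l} = coeffX0 (frobeniusProduct n) := by
  ext1 m
  rw [coeff_listSeries_isPrimc_eq_sum hn, sum_coeff_rowPoly, coeff_coeffX0_frobeniusProduct]

end Primc

/-! ### Which free colours fit between two neighbours. -/

section Keys

/-- The difference condition for consecutive parts, from left to right. -/
def StepDown (x y : Part) : Prop := y.size + deltaNat x.colour y.colour ≤ x.size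

/-- Along a generalised Primc partition, the sizes decrease, and among parts of the same size the
bound colours `a_k b_l` with `k < l` come first and those with `k > l` last. -/
def partKey (x : Part) : ℕ :=
  3 * x.size + (if x.colour.1 < x.colour.2 then 2 else if x.colour.1 = x.colour.2 then 1 else 0)

theorem StepDown.partKey_le {x y : Part} (h : StepDown x y) : partKey y ≤ partKey x := by
  obtain ⟨p, k, l⟩ := x
  obtain ⟨q, k', l'⟩ := y
  unfold StepDown deltaNat at h
  unfold partKey
  simp only at h ⊢
  split_ifs at h ⊢ <;> omega

/-- Distinct free colours have `Δ = 1`, so free parts of equal size must agree. -/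
theorem StepDown.eq_of_partKey {x y : Part} {M : ℕ} (h : StepDown x y)
    (hx : partKey x = 3 * M + 1) (hy : partKey y = 3 * M + 1) : x = y := by
  obtain ⟨p, k, l⟩ := x
  obtain ⟨q, k', l'⟩ := y
  unfold StepDown deltaNat at h
  unfold partKey at hx hy
  simp only [Part.mk.injEq, Prod.mk.injEq] at h hx hy ⊢
  split_ifs at h hx hy <;> omega

theorem partKey_eq_iff {x : Part} {M : ℕ} :
    partKey x = 3 * M + 1 ↔ ∃ i, x = part M i i := by
  constructor
  · intro h
    obtain ⟨p, k, l⟩ := x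
    unfold partKey at h
    refine ⟨k, ?_⟩
    simp only [Part.mk.injEq, Prod.mk.injEq, true_and] at h ⊢
    split_ifs at h <;> omega
  · rintro ⟨i, rfl⟩
    simp [partKey]

/-- A triangle inequality for `Δ` through a free colour; it allows free parts to be deleted. -/
theorem StepDown.trans_free {x y : Part} {p i : ℕ} (h : StepDown x (part p i i))
    (h' : StepDown (part p i i) y) : StepDown x y := by
  obtain ⟨q, k, l⟩ := x
  obtain ⟨q', k', l'⟩ := y
  unfold StepDown deltaNat at *
  simp only at *
  split_ifs at * <;> omega

theorem stepDown_free_self (p i : ℕ) : StepDown (part p i i) (part p i i) := by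
  simp [StepDown, deltaNat]

/-- For a bound colour, `Δ(a_k b_l, a_i b_i) = χ(i ≤ k) + χ(l < i)`. This is 0 for `k < i ≤ l`, 2
for `l < i ≤ k` and 1 otherwise. -/
theorem stepDown_free_right {x : Part} {M i : ℕ} (hx : 3 * M + 1 < partKey x) :
    StepDown x (part M i i) ↔
      (x.size = M → x.colour.1 < i ∧ i ≤ x.colour.2) ∧
      (x.size = M + 1 → ¬ (x.colour.2 < i ∧ i ≤ x.colour.1)) := by
  obtain ⟨p, k, l⟩ := x
  unfold partKey at hx
  unfold StepDown deltaNat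
  simp only [and_true] at hx ⊢
  split_ifs at hx ⊢ <;> omega

theorem stepDown_free_left {y : Part} {M i : ℕ} (hy : partKey y < 3 * M + 1) :
    StepDown (part M i i) y ↔
      (y.size = M → y.colour.2 < i ∧ i ≤ y.colour.1) ∧
      (y.size + 1 = M → ¬ (y.colour.1 < i ∧ i ≤ y.colour.2)) := by
  obtain ⟨p, k, l⟩ := y
  unfold partKey at hy
  unfold StepDown deltaNat
  simp only [true_and] at hy ⊢
  split_ifs at hy ⊢ <;> omega

/-- The colour of the left neighbour of a free part of size `M` when it restricts the colour of
that part, with `true` if the sizes are equal. -/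
def leftNeighbour (M : ℕ) : Option Part → Option (Bool × Colour)
  | none => none
  | some x => if x.size = M then some (true, x.colour) else
      if x.size = M + 1 ∧ x.colour.2 < x.colour.1 then some (false, x.colour) else none

/-- The colour of the right neighbour of a free part of size `M` when it restricts the colour of
that part, with `true` if the sizes are equal. -/
def rightNeighbour (M : ℕ) : Option Part → Option (Bool × Colour)
  | none => none
  | some y => if y.size = M then some (true, y.colour) else
      if y.size + 1 = M ∧ y.colour.1 < y.colour.2 then some (false, y.colour) else none

/-- The index `i` of the forbidden free colour `a_i b_i` between two neighbours. -/
def forbiddenIndex (δ : Colour → ℤ) (γ : Colour → Colour → ℤ) :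
    Option (Bool × Colour) → Option (Bool × Colour) → ℤ
  | none, some (true, c) => δ c
  | some (true, c), none => δ c
  | some (true, c), some (_, d) => γ c d
  | some (false, c), some (true, d) => γ c d
  -- Here neither neighbour has size `M`. Each neighbour at most excludes an interval of positive
  -- indices, so `a_0 b_0` is admissible.
  | _, _ => 0

/-- The index of the forbidden colour for a free part of size `M` with given neighbours. -/
def forbidden (δ : Colour → ℤ) (γ : Colour → Colour → ℤ) (M : ℕ) (L R : Option Part) : ℤ :=
  forbiddenIndex δ γ (leftNeighbour M L) (rightNeighbour M R)

variable {n : ℕ} {δ : Colour → ℤ} {γ : Colour → Colour → ℤ}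

theorem leftNeighbour_cases {M : ℕ} {L : Option Part} (hL : ∀ x ∈ L, 3 * M + 1 < partKey x) :
    (leftNeighbour M L = none ∧ ∀ x ∈ L, ∀ i, StepDown x (part M i i)) ∨
    (∃ k l, L = some (part M k l) ∧ k < l ∧ leftNeighbour M L = some (true, (k, l))) ∨
    (∃ k l, L = some (part (M + 1) k l) ∧ l < k ∧ leftNeighbour M L = some (false, (k, l))) := by
  match L, hL with
  | none, _ => exact Or.inl ⟨rfl, by simp⟩
  | some ⟨p, k, l⟩, hL =>
    have hx := hL _ rfl
    have hs : ∀ i, StepDown ⟨p, k, l⟩ (part M i i) ↔ _ := fun i => stepDown_free_right hx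
    unfold partKey at hx
    simp only at hx hs
    unfold leftNeighbour
    simp only
    by_cases h1 : p = M
    · subst h1
      refine Or.inr (Or.inl ⟨k, l, rfl, ?_, by simp⟩)
      split_ifs at hx <;> omega
    · by_cases h2 : p = M + 1 ∧ l < k
      · obtain ⟨rfl, h2⟩ := h2
        exact Or.inr (Or.inr ⟨k, l, rfl, h2, by simp [h2]⟩)
      · refine Or.inl ⟨by rw [if_neg h1, if_neg h2], ?_⟩
        rintro x hx' i
        obtain rfl := Option.some.inj hx'
        rw [hs]
        omega

theorem rightNeighbour_cases {M : ℕ} {R : Option Part} (hR : ∀ y ∈ R, partKey y < 3 * M + 1) :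
    (rightNeighbour M R = none ∧ ∀ y ∈ R, ∀ i, StepDown (part M i i) y) ∨
    (∃ k l, R = some (part M k l) ∧ l < k ∧ rightNeighbour M R = some (true, (k, l))) ∨
    (∃ p k l, M = p + 1 ∧ R = some (part p k l) ∧ k < l ∧
      rightNeighbour M R = some (false, (k, l))) := by
  match R, hR with
  | none, _ => exact Or.inl ⟨rfl, by simp⟩
  | some ⟨p, k, l⟩, hR =>
    have hx := hR _ rfl
    have hs : ∀ i, StepDown (part M i i) ⟨p, k, l⟩ ↔ _ := fun i => stepDown_free_left hx
    unfold partKey at hx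
    simp only at hx hs
    unfold rightNeighbour
    simp only
    by_cases h1 : p = M
    · subst h1
      refine Or.inr (Or.inl ⟨k, l, rfl, ?_, by simp⟩)
      split_ifs at hx <;> omega
    · by_cases h2 : p + 1 = M ∧ k < l
      · obtain ⟨rfl, h2⟩ := h2
        exact Or.inr (Or.inr ⟨p, k, l, rfl, rfl, h2, by simp [h2]⟩)
      · refine Or.inl ⟨by rw [if_neg h1, if_neg h2], ?_⟩
        rintro x hx' i
        obtain rfl := Option.some.inj hx'
        rw [hs]
        omega

theorem nonempty_interval_diff {l₁ k₁ l₂ k₂ : ℕ} (h : ¬ (l₁ ≤ l₂ ∧ k₂ ≤ k₁)) (h2 : l₂ < k₂) : (interval l₂ k₂ \ interval l₁ k₁).Nonempty := by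
  by_cases h3 : l₁ ≤ l₂
  · exact ⟨k₂, by simp only [interval, Set.mem_sdiff, Set.mem_Icc]; omega⟩
  · exact ⟨l₂ + 1, by simp only [interval, Set.mem_sdiff, Set.mem_Icc]; omega⟩

/-- The forbidden colour is one of the colours that the difference conditions allow. -/
theorem exists_eq_forbidden (hn : 0 < n) (hδ : Condition1 δ) (hγ : Condition2 γ) {M : ℕ}
    {L R : Option Part} (hL : ∀ x ∈ L, 3 * M + 1 < partKey x)
    (hR : ∀ y ∈ R, partKey y < 3 * M + 1)
    (hLn : ∀ x ∈ L, x.colour.1 < n ∧ x.colour.2 < n)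
    (hRn : ∀ y ∈ R, y.colour.1 < n ∧ y.colour.2 < n)
    (hLR : ∀ x ∈ L, ∀ y ∈ R, StepDown x y) :
    ∃ i : ℕ, i < n ∧ (i : ℤ) = forbidden δ γ M L R ∧ (∀ x ∈ L, StepDown x (part M i i)) ∧
      ∀ y ∈ R, StepDown (part M i i) y := by
  unfold forbidden
  rcases leftNeighbour_cases hL with ⟨eL, sL⟩ | ⟨k, l, rfl, hkl, eL⟩ | ⟨k, l, rfl, hkl, eL⟩ <;>
  rcases rightNeighbour_cases hR with ⟨eR, sR⟩ | ⟨k', l', rfl, hkl', eR⟩ |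
    ⟨p, k', l', rfl, rfl, hkl', eR⟩ <;>
  rw [eL, eR] <;> unfold forbiddenIndex <;>
  simp only [Option.mem_def, Option.some.injEq, forall_eq'] at *
  · exact ⟨0, hn, rfl, fun x hx => sL x hx 0, fun y hy => sR y hy 0⟩
  · have := hδ k' l' hkl'.ne'
    refine ⟨(δ (k', l')).toNat, by omega, by omega, fun x hx => sL x hx _, ?_⟩
    rw [stepDown_free_left hR]
    simp only
    omega
  · refine ⟨0, hn, rfl, fun x hx => sL x hx 0, ?_⟩
    rw [stepDown_free_left hR]
    simp only
    omega
  · have := hδ k l hkl.ne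
    refine ⟨(δ (k, l)).toNat, by omega, by omega, ?_, fun y hy => sR y hy _⟩
    rw [stepDown_free_right hL]
    simp only
    omega
  · have h1 : max k l' < min k' l := by
      unfold StepDown deltaNat at hLR
      simp only at hLR
      split_ifs at hLR <;> omega
    have := hγ.max_lt_min k l k' l' h1
    refine ⟨(γ (k, l) (k', l')).toNat, by omega, by omega, ?_, ?_⟩
    · rw [stepDown_free_right hL]
      simp only
      omega
    · rw [stepDown_free_left hR]
      simp only
      omega
  · have h1 : ¬ (k' ≤ k ∧ l ≤ l') := by
      unfold StepDown deltaNat at hLR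
      simp only at hLR
      split_ifs at hLR <;> omega
    have := hγ.lt_lt k l k' l' hkl hkl' (nonempty_interval_diff h1 hkl)
    simp only [interval, Set.mem_sdiff, Set.mem_Icc] at this
    refine ⟨(γ (k, l) (k', l')).toNat, by omega, by omega, ?_, ?_⟩
    · rw [stepDown_free_right hL]
      simp only
      omega
    · rw [stepDown_free_left hR]
      simp only
      omega
  · refine ⟨0, hn, rfl, ?_, fun y hy => sR y hy 0⟩
    rw [stepDown_free_right hL]
    simp only
    omega
  · have h1 : ¬ (l ≤ l' ∧ k' ≤ k) := by
      unfold StepDown deltaNat at hLR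
      simp only at hLR
      split_ifs at hLR <;> omega
    have := hγ.gt_gt k l k' l' hkl hkl' (nonempty_interval_diff h1 hkl')
    simp only [interval, Set.mem_sdiff, Set.mem_Icc] at this
    refine ⟨(γ (k, l) (k', l')).toNat, by omega, by omega, ?_, ?_⟩
    · rw [stepDown_free_right hL]
      simp only
      omega
    · rw [stepDown_free_left hR]
      simp only
      omega
  · refine ⟨0, hn, rfl, ?_, ?_⟩
    · rw [stepDown_free_right hL]
      simp only
      omega
    · rw [stepDown_free_left hR]
      simp only
      omega

/-- If the colour `a_0 b_0` is allowed then it is the forbidden one. -/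
theorem forbidden_eq_zero {M : ℕ} {L R : Option Part} (hL : ∀ x ∈ L, 3 * M + 1 < partKey x)
    (hR : ∀ y ∈ R, partKey y < 3 * M + 1) (sL : ∀ x ∈ L, StepDown x (part M 0 0))
    (sR : ∀ y ∈ R, StepDown (part M 0 0) y) : forbidden δ γ M L R = 0 := by
  unfold forbidden
  rcases leftNeighbour_cases hL with ⟨eL, -⟩ | ⟨k, l, rfl, hkl, eL⟩ | ⟨k, l, rfl, hkl, eL⟩
  -- A neighbour of size `M` forces a positive index, so it cannot be next to `a_0 b_0`.
  on_goal 2 =>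
    have := (stepDown_free_right (hL _ rfl)).mp (sL _ rfl)
    simp at this
  all_goals
    rcases rightNeighbour_cases hR with ⟨eR, -⟩ | ⟨k', l', rfl, hkl', eR⟩ |
      ⟨p, k', l', rfl, rfl, hkl', eR⟩
    on_goal 2 =>
      have := (stepDown_free_left (hR _ rfl)).mp (sR _ rfl)
      simp at this
    all_goals rw [eL, eR]; rfl

end Keys

/-! ### Cutting a partition at its free parts of size `M`. -/

section Split

/-- The parts before the free parts of size `M`. -/
def partsAbove (M : ℕ) (l : List Part) : List Part := l.filter fun x => 3 * M + 1 < partKey x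

/-- The free parts of size `M`. -/
def freeParts (M : ℕ) (l : List Part) : List Part := l.filter fun x => partKey x = 3 * M + 1

/-- The parts after the free parts of size `M`. -/
def partsBelow (M : ℕ) (l : List Part) : List Part := l.filter fun x => partKey x < 3 * M + 1

theorem pairwise_partKey {l : List Part} (h : l.IsChain StepDown) :
    l.Pairwise fun x y => partKey y ≤ partKey x := by
  have h1 : l.IsChain fun x y => partKey y ≤ partKey x := h.imp fun _ _ h => h.partKey_le
  have : IsTrans Part fun x y => partKey y ≤ partKey x := ⟨fun _ _ _ h h' => h'.trans h⟩
  exact h1.pairwise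

/-- The keys decrease weakly along the list, so the three filters select consecutive blocks. -/
theorem split_of_isChain (M : ℕ) {l : List Part} (h : l.IsChain StepDown) :
    partsAbove M l ++ (freeParts M l ++ partsBelow M l) = l := by
  have h2 := pairwise_partKey h
  clear h
  unfold partsAbove freeParts partsBelow
  induction l with
  | nil => rfl
  | cons x l ih =>
    rw [List.pairwise_cons] at h2
    have ih := ih h2.2
    rcases lt_trichotomy (partKey x) (3 * M + 1) with hx | hx | hx
    · have e1 : l.filter (fun x => 3 * M + 1 < partKey x) = [] := by
        rw [List.filter_eq_nil_iff]
        intro y hy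
        have := h2.1 y hy
        simp; omega
      have e2 : l.filter (fun x => partKey x = 3 * M + 1) = [] := by
        rw [List.filter_eq_nil_iff]
        intro y hy
        have := h2.1 y hy
        simp; omega
      rw [e1, e2] at ih
      rw [List.filter_cons_of_neg (by simp; omega), List.filter_cons_of_neg (by simp; omega),
        List.filter_cons_of_pos (by simpa using hx), e1, e2]
      simpa using ih
    · have e1 : l.filter (fun x => 3 * M + 1 < partKey x) = [] := by
        rw [List.filter_eq_nil_iff]
        intro y hy
        have := h2.1 y hy
        simp; omega
      rw [e1] at ih
      rw [List.filter_cons_of_neg (by simp; omega), List.filter_cons_of_pos (by simpa using hx),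
        List.filter_cons_of_neg (by simp; omega), e1]
      simpa using ih
    · rw [List.filter_cons_of_pos (by simpa using hx), List.filter_cons_of_neg (by simp; omega),
        List.filter_cons_of_neg (by simp; omega)]
      simpa using ih

/-- A list that is decomposed into parts above, equal to and below the free parts of size `M`. -/
structure IsSplit (M : ℕ) (H F T : List Part) : Prop where
  above : ∀ x ∈ H, 3 * M + 1 < partKey x
  free : ∀ x ∈ F, partKey x = 3 * M + 1
  below : ∀ x ∈ T, partKey x < 3 * M + 1

theorem isSplit (M : ℕ) (l : List Part) :
    IsSplit M (partsAbove M l) (freeParts M l) (partsBelow M l) where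
  above x hx := by simpa using List.of_mem_filter hx
  free x hx := by simpa using List.of_mem_filter hx
  below x hx := by simpa using List.of_mem_filter hx

theorem IsSplit.partsAbove_eq {M : ℕ} {H F T : List Part} (h : IsSplit M H F T) :
    partsAbove M (H ++ (F ++ T)) = H := by
  unfold partsAbove
  rw [List.filter_append, List.filter_append, List.filter_eq_self.mpr,
    List.filter_eq_nil_iff.mpr, List.filter_eq_nil_iff.mpr, List.append_nil, List.append_nil]
  · intro x hx; have := h.below x hx; simp; omega
  · intro x hx; have := h.free x hx; simp; omega
  · intro x hx; simpa using h.above x hx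

theorem IsSplit.freeParts_eq {M : ℕ} {H F T : List Part} (h : IsSplit M H F T) :
    freeParts M (H ++ (F ++ T)) = F := by
  unfold freeParts
  rw [List.filter_append, List.filter_append, List.filter_eq_nil_iff.mpr,
    List.filter_eq_self.mpr, List.filter_eq_nil_iff.mpr, List.append_nil, List.nil_append]
  · intro x hx; have := h.below x hx; simp; omega
  · intro x hx; simpa using h.free x hx
  · intro x hx; have := h.above x hx; simp; omega

theorem IsSplit.partsBelow_eq {M : ℕ} {H F T : List Part} (h : IsSplit M H F T) :
    partsBelow M (H ++ (F ++ T)) = T := by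
  unfold partsBelow
  rw [List.filter_append, List.filter_append, List.filter_eq_nil_iff.mpr,
    List.filter_eq_nil_iff.mpr, List.filter_eq_self.mpr, List.nil_append, List.nil_append]
  · intro x hx; simpa using h.below x hx
  · intro x hx; have := h.free x hx; simp; omega
  · intro x hx; have := h.above x hx; simp; omega

theorem isPrimc_iff {n : ℕ} {l : List Part} : IsPrimc n l ↔
    (∀ x ∈ l, 1 ≤ x.size ∧ x.colour.1 < n ∧ x.colour.2 < n) ∧ l.IsChain StepDown := by
  have h : l.IsChain (fun x y => Delta x.colour y.colour ≤ (x.size : ℤ) - (y.size : ℤ))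
      ↔ l.IsChain StepDown := by
    refine List.IsChain.iff fun x y => ?_
    unfold StepDown
    rw [← coe_deltaNat]
    omega
  constructor
  · rintro ⟨h1, h2, h3⟩
    exact ⟨fun x hx => ⟨h1 x hx, h2 x hx⟩, h.mp h3⟩
  · rintro ⟨h1, h2⟩
    exact ⟨fun x hx => (h1 x hx).1, fun x hx => (h1 x hx).2, h.mpr h2⟩

theorem isChain_remove {H X : List Part} {p i : ℕ}
    (h : (H ++ part p i i :: X).IsChain StepDown) : (H ++ X).IsChain StepDown := by
  rw [List.isChain_append, List.isChain_cons] at h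
  obtain ⟨h1, ⟨h2, h3⟩, h4⟩ := h
  exact h1.append h3 fun x hx y hy => (h4 x hx _ rfl).trans_free (h2 y hy)

theorem isChain_insert {H X : List Part} {f : Part} (h : (H ++ X).IsChain StepDown)
    (hH : ∀ x ∈ H.getLast?, StepDown x f) (hX : ∀ y ∈ X.head?, StepDown f y) :
    (H ++ f :: X).IsChain StepDown := by
  rw [List.isChain_append] at h
  refine h.1.append (List.isChain_cons.mpr ⟨hX, h.2.1⟩) fun x hx y hy => ?_
  obtain rfl : f = y := by simpa using hy
  exact hH x hx

end Split

/-! ### Inserting free parts, one size at a time. -/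

section Good
variable {n : ℕ} {δ : Colour → ℤ} {γ : Colour → Colour → ℤ}

/-- There is at most one free part of size `M`, and its colour is not the forbidden one. -/
def IsGood (δ : Colour → ℤ) (γ : Colour → Colour → ℤ) (M : ℕ) (l : List Part) : Prop :=
  freeParts M l = [] ∨ ∃ x, freeParts M l = [x] ∧
    (x.colour.1 : ℤ) ≠ forbidden δ γ M (partsAbove M l).getLast? (partsBelow M l).head?

/-- A free part of size `M`, of the same colour as those in `l` if there are any, and of the
forbidden colour otherwise. -/
def extraPart (δ : Colour → ℤ) (γ : Colour → Colour → ℤ) (M : ℕ) (H F T : List Part) : Part :=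
  -- For Primc partitions the forbidden index is a natural number by `exists_eq_forbidden`, so
  -- `toNat` loses nothing.
  F.head?.getD (part M (forbidden δ γ M H.getLast? T.head?).toNat
    (forbidden δ γ M H.getLast? T.head?).toNat)

/-- Insert a free part of size `M`. -/
def insertFree (δ : Colour → ℤ) (γ : Colour → Colour → ℤ) (M : ℕ) (l : List Part) : List Part :=
  partsAbove M l ++ (extraPart δ γ M (partsAbove M l) (freeParts M l) (partsBelow M l) ::
    freeParts M l ++ partsBelow M l)

theorem partKey_extraPart {M : ℕ} {H F T : List Part} (h : IsSplit M H F T) :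
    partKey (extraPart δ γ M H F T) = 3 * M + 1 := by
  unfold extraPart
  cases F with
  | nil => exact partKey_eq_iff.mpr ⟨_, rfl⟩
  | cons x F => exact h.free x List.mem_cons_self

theorem IsSplit.cons_extraPart {M : ℕ} {H F T : List Part} (h : IsSplit M H F T) :
    IsSplit M H (extraPart δ γ M H F T :: F) T where
  above := h.above
  free x hx := by
    rcases List.mem_cons.mp hx with rfl | hx
    · exact partKey_extraPart h
    · exact h.free x hx
  below := h.below

/-- The three blocks can be read off from the result, and the inserted part is the head of the free
block. -/
theorem insertFree_injOn (M : ℕ) : Set.InjOn (insertFree δ γ M) {l | l.IsChain StepDown} := by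
  intro l hl l' hl' h
  have s := (isSplit M l).cons_extraPart (δ := δ) (γ := γ)
  have s' := (isSplit M l').cons_extraPart (δ := δ) (γ := γ)
  unfold insertFree at h
  have e1 := congrArg (partsAbove M) h
  have e2 := congrArg (freeParts M) h
  have e3 := congrArg (partsBelow M) h
  rw [s.partsAbove_eq, s'.partsAbove_eq] at e1
  rw [s.freeParts_eq, s'.freeParts_eq] at e2
  rw [s.partsBelow_eq, s'.partsBelow_eq] at e3
  rw [← split_of_isChain M hl, ← split_of_isChain M hl', e1, (List.cons.inj e2).2, e3]

theorem leftNeighbour_eq_none_of_lt {M N : ℕ} (h : M < N) {x : Part}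
    (hx : 3 * N + 1 ≤ partKey x) : leftNeighbour M (some x) = none := by
  obtain ⟨p, k, l⟩ := x
  unfold partKey at hx
  unfold leftNeighbour
  simp only at hx ⊢
  rw [if_neg, if_neg]
  · split_ifs at hx <;> omega
  · split_ifs at hx <;> omega

theorem leftNeighbour_getLast? {M N : ℕ} (h : M < N) (H X : List Part)
    (hH : ∀ x ∈ H, 3 * N + 1 ≤ partKey x) :
    leftNeighbour M (H ++ X).getLast? = leftNeighbour M X.getLast? := by
  rw [List.getLast?_append]
  cases hX : X.getLast? with
  | some x => rfl
  | none =>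
    rw [Option.none_or]
    cases hH' : H.getLast? with
    | none => rfl
    | some x => exact leftNeighbour_eq_none_of_lt h (hH x (List.mem_of_getLast? hH'))

/-- A left neighbour that restricts a free part of size `M` has key at most `3 * M + 3`, which is
less than `3 * N + 1`. Hence insertions at size `N` do not affect goodness at smaller sizes. -/
theorem isGood_append_iff {M N : ℕ} (h : M < N) (H T : List Part)
    (hH : ∀ x ∈ H, 3 * N + 1 ≤ partKey x) : IsGood δ γ M (H ++ T) ↔ IsGood δ γ M T := by
  have e1 : freeParts M (H ++ T) = freeParts M T := by
    unfold freeParts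
    rw [List.filter_append, List.filter_eq_nil_iff.mpr, List.nil_append]
    intro x hx; have := hH x hx; simp; omega
  have e2 : partsBelow M (H ++ T) = partsBelow M T := by
    unfold partsBelow
    rw [List.filter_append, List.filter_eq_nil_iff.mpr, List.nil_append]
    intro x hx; have := hH x hx; simp; omega
  have e3 : partsAbove M (H ++ T) = H ++ partsAbove M T := by
    unfold partsAbove
    rw [List.filter_append, List.filter_eq_self.mpr]
    intro x hx; have := hH x hx; simp; omega
  unfold IsGood forbidden
  rw [e1, e2, e3, leftNeighbour_getLast? h H _ hH]

theorem IsSplit.isGood_iff {M N : ℕ} (h : M < N) {H F T : List Part} (s : IsSplit N H F T) :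
    IsGood δ γ M (H ++ (F ++ T)) ↔ IsGood δ γ M T := by
  rw [← List.append_assoc]
  refine isGood_append_iff h _ _ fun x hx => ?_
  rcases List.mem_append.mp hx with hx | hx
  · exact (s.above x hx).le
  · exact (s.free x hx).ge

/-- The generalised Primc partitions that are good at all sizes less than `M`. -/
def goodBelow (n : ℕ) (δ : Colour → ℤ) (γ : Colour → Colour → ℤ) (M : ℕ) : Set (List Part) :=
  {l | IsPrimc n l ∧ ∀ N < M, IsGood δ γ N l}

/-- A repeated free colour has `Δ = 0`, and without free parts of size `M` the forbidden colour is
admissible by `exists_eq_forbidden`. The hypothesis `hM` keeps the parts positive. -/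
theorem insertFree_mem_goodBelow (hn : 0 < n) (hδ : Condition1 δ) (hγ : Condition2 γ) {M : ℕ}
    (hM : 0 < M) {l : List Part} (h : l ∈ goodBelow n δ γ M) :
    insertFree δ γ M l ∈ goodBelow n δ γ M := by
  obtain ⟨h1, h2⟩ := h
  rw [isPrimc_iff] at h1
  obtain ⟨h1, h3⟩ := h1
  have hs := split_of_isChain M h3
  have s := isSplit M l
  unfold insertFree
  generalize partsAbove M l = H at *
  generalize freeParts M l = F at *
  generalize partsBelow M l = T at *
  subst hs
  refine ⟨isPrimc_iff.mpr ?_, fun N hN => ?_⟩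
  · suffices hf : (1 ≤ (extraPart δ γ M H F T).size ∧ (extraPart δ γ M H F T).colour.1 < n ∧
        (extraPart δ γ M H F T).colour.2 < n) ∧
        (∀ x ∈ H.getLast?, StepDown x (extraPart δ γ M H F T)) ∧
        ∀ y ∈ (F ++ T).head?, StepDown (extraPart δ γ M H F T) y by
      refine ⟨fun x hx => ?_, isChain_insert h3 hf.2.1 hf.2.2⟩
      rcases List.mem_append.mp hx with hx | hx
      · exact h1 x (List.mem_append_left _ hx)
      · rcases List.mem_cons.mp hx with rfl | hx
        · exact hf.1
        · exact h1 x (List.mem_append_right _ hx)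
    cases F with
    | nil =>
      rw [List.nil_append] at *
      obtain ⟨i, hi1, hi2, hi3, hi4⟩ := exists_eq_forbidden (L := H.getLast?) (R := T.head?)
        hn hδ hγ (fun x hx => s.above x (List.mem_of_getLast? hx))
        (fun y hy => s.below y (List.mem_of_head? hy))
        (fun x hx => (h1 x (List.mem_append_left _ (List.mem_of_getLast? hx))).2)
        (fun y hy => (h1 y (List.mem_append_right _ (List.mem_of_head? hy))).2)
        (List.isChain_append.mp h3).2.2
      have e : extraPart δ γ M H [] T = part M i i := by
        unfold extraPart
        rw [← hi2]
        rfl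
      rw [e]
      exact ⟨⟨hM, hi1, hi1⟩, hi3, hi4⟩
    | cons f F =>
      have e : extraPart δ γ M H (f :: F) T = f := rfl
      obtain ⟨i, hi⟩ := partKey_eq_iff.mp (s.free f List.mem_cons_self)
      rw [e]
      refine ⟨h1 f (by simp), fun x hx => (List.isChain_append.mp h3).2.2 x hx f rfl, ?_⟩
      intro y hy
      obtain rfl : f = y := by simpa using hy
      rw [hi]
      exact stepDown_free_self M i
  · rw [s.cons_extraPart.isGood_iff hN]
    exact (s.isGood_iff hN).mp (h2 N hN)

/-- The result has two free parts of size `M`, or a single one of the forbidden colour. -/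
theorem not_isGood_insertFree (hn : 0 < n) (hδ : Condition1 δ) (hγ : Condition2 γ) {M : ℕ}
    {l : List Part} (h : l ∈ goodBelow n δ γ M) : ¬ IsGood δ γ M (insertFree δ γ M l) := by
  have h1 := isPrimc_iff.mp h.1
  obtain ⟨h1, h3⟩ := h1
  have hs := split_of_isChain M h3
  have s := isSplit M l
  have s' := s.cons_extraPart (δ := δ) (γ := γ)
  unfold IsGood insertFree
  rw [s'.partsAbove_eq, s'.freeParts_eq, s'.partsBelow_eq]
  generalize partsAbove M l = H at *
  generalize freeParts M l = F at *
  generalize partsBelow M l = T at *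
  subst hs
  rintro (h4 | ⟨x, h4, h5⟩)
  · simp at h4
  · obtain ⟨rfl, rfl⟩ := List.cons.inj h4
    rw [List.nil_append] at *
    obtain ⟨i, hi1, hi2, hi3, hi4⟩ := exists_eq_forbidden (L := H.getLast?) (R := T.head?)
      hn hδ hγ (fun x hx => s.above x (List.mem_of_getLast? hx))
      (fun y hy => s.below y (List.mem_of_head? hy))
      (fun x hx => (h1 x (List.mem_append_left _ (List.mem_of_getLast? hx))).2)
      (fun y hy => (h1 y (List.mem_append_right _ (List.mem_of_head? hy))).2)
      (List.isChain_append.mp h3).2.2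
    refine h5 ?_
    unfold extraPart
    rw [← hi2]
    rfl

/-- Delete the first free part of size `M`. If another one remains, it has the same colour;
otherwise the deleted colour was the forbidden one. In both cases `extraPart` restores it. -/
theorem exists_eq_insertFree {M : ℕ} {l : List Part}
    (h : l ∈ goodBelow n δ γ M) (hl : ¬ IsGood δ γ M l) :
    ∃ l' ∈ goodBelow n δ γ M, insertFree δ γ M l' = l := by
  obtain ⟨h1, h2⟩ := h
  rw [isPrimc_iff] at h1
  obtain ⟨h1, h3⟩ := h1
  have hs := split_of_isChain M h3
  have s := isSplit M l
  unfold IsGood at hl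
  generalize partsAbove M l = H at *
  generalize freeParts M l = F at *
  generalize partsBelow M l = T at *
  subst hs
  cases F with
  | nil => simp at hl
  | cons f F =>
    have s' : IsSplit M H F T := ⟨s.above, fun x hx => s.free x (List.mem_cons_of_mem _ hx), s.below⟩
    obtain ⟨i, rfl⟩ := partKey_eq_iff.mp (s.free f List.mem_cons_self)
    refine ⟨H ++ (F ++ T), ⟨isPrimc_iff.mpr ⟨fun x hx => h1 x ?_, isChain_remove h3⟩,
      fun N hN => ?_⟩, ?_⟩
    · simp only [List.mem_append, List.cons_append, List.mem_cons] at hx ⊢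
      tauto
    · rw [s'.isGood_iff hN]
      exact (s.isGood_iff hN).mp (h2 N hN)
    · unfold insertFree
      rw [s'.partsAbove_eq, s'.freeParts_eq, s'.partsBelow_eq]
      congr 3
      unfold extraPart
      cases F with
      | nil =>
        have : (i : ℤ) = forbidden δ γ M H.getLast? T.head? := by
          by_contra hne
          exact hl (Or.inr ⟨_, rfl, hne⟩)
        rw [← this]
        rfl
      | cons g F =>
        have hfg : StepDown (part M i i) g :=
          (List.isChain_cons.mp (List.isChain_append.mp h3).2.1).1 g rfl
        exact (hfg.eq_of_partKey (s.free _ List.mem_cons_self)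
          (s.free g (List.mem_cons_of_mem _ List.mem_cons_self))).symm

/-- The inserted part has size `M` and weight 1, so this disjoint union says that goodness at `M`
multiplies the series by `1 - q^M`. -/
theorem goodBelow_eq_union (hn : 0 < n) (hδ : Condition1 δ) (hγ : Condition2 γ) {M : ℕ}
    (hM : 0 < M) : goodBelow n δ γ M =
      goodBelow n δ γ (M + 1) ∪ insertFree δ γ M '' goodBelow n δ γ M := by
  ext l
  constructor
  · intro h
    by_cases hl : IsGood δ γ M l
    · refine Or.inl ⟨h.1, fun N hN => ?_⟩
      rcases Nat.lt_succ_iff_lt_or_eq.mp hN with hN | rfl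
      · exact h.2 N hN
      · exact hl
    · exact Or.inr (exists_eq_insertFree h hl)
  · rintro (h | ⟨l, h, rfl⟩)
    · exact ⟨h.1, fun N hN => h.2 N (Nat.lt_succ_of_lt hN)⟩
    · exact insertFree_mem_goodBelow hn hδ hγ hM h

theorem listSize_append (l l' : List Part) : listSize (l ++ l') = listSize l + listSize l' := by
  simp [listSize]

theorem listWeight_append (l l' : List Part) :
    listWeight n (l ++ l') = listWeight n l * listWeight n l' := by
  simp [listWeight]

open PowerSeries in
theorem listSeries_goodBelow_succ (hn : 0 < n) (hδ : Condition1 δ) (hγ : Condition2 γ) {M : ℕ}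
    (hM : 0 < M) : listSeries n (goodBelow n δ γ (M + 1))
      = (1 - X ^ M) * listSeries n (goodBelow n δ γ M) := by
  have hfin : ∀ M m, (sizeFiber (goodBelow n δ γ M) m).Finite := fun M =>
    finite_sizeFiber_mono (T := {l | IsPrimc n l}) (fun _ hl => hl.1) finite_isPrimc
  have hfin' := hfin M
  have h := congrArg (listSeries n) (goodBelow_eq_union hn hδ hγ hM)
  rw [goodBelow_eq_union hn hδ hγ hM] at hfin'
  rw [listSeries_union (hfin (M + 1)) (finite_sizeFiber_mono Set.subset_union_right hfin'),
    listSeries_image (n := n) (S := goodBelow n δ γ M) _ 1 M (hfin M), map_one, one_mul] at h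
  · rw [sub_mul, one_mul, sub_eq_iff_eq_add.mpr h]
  · exact (insertFree_injOn M).mono fun l hl => (isPrimc_iff.mp hl.1).2
  · intro l hl
    have hs := split_of_isChain M (isPrimc_iff.mp hl.1).2
    obtain ⟨i, hi⟩ := partKey_eq_iff.mp (partKey_extraPart (δ := δ) (γ := γ) (isSplit M l))
    conv_rhs => rw [← hs]
    unfold insertFree
    rw [List.cons_append, listSize_append, listSize_append, hi]
    simp only [listSize, List.map_cons, List.sum_cons]
    omega
  · intro l hl
    have hs := split_of_isChain M (isPrimc_iff.mp hl.1).2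
    obtain ⟨i, hi⟩ := partKey_eq_iff.mp (partKey_extraPart (δ := δ) (γ := γ) (isSplit M l))
    conv_rhs => rw [← hs]
    unfold insertFree
    rw [List.cons_append, listWeight_append, listWeight_append, hi, listWeight_cons,
      aSymb_mul_bSymb]
    ring
  · rw [Set.disjoint_left]
    rintro _ h1 ⟨l, hl, rfl⟩
    exact not_isGood_insertFree hn hδ hγ hl (h1.2 M (Nat.lt_succ_self M))

theorem isGood_of_size {l : List Part} {M : ℕ} (h : ∀ x ∈ l, x.size ≠ M) : IsGood δ γ M l := by
  refine Or.inl (List.filter_eq_nil_iff.mpr fun x hx => ?_)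
  rw [decide_eq_true_eq]
  intro hk
  obtain ⟨i, rfl⟩ := partKey_eq_iff.mp hk
  exact h _ hx rfl

open PowerSeries in
theorem listSeries_goodBelow (hn : 0 < n) (hδ : Condition1 δ) (hγ : Condition2 γ) (M : ℕ) :
    listSeries n (goodBelow n δ γ (M + 1))
      = (∏ j ∈ Finset.range M, (1 - X ^ (j + 1))) * listSeries n {l | IsPrimc n l} := by
  induction M with
  | zero =>
    rw [Finset.range_zero, Finset.prod_empty, one_mul]
    congr 1
    ext l
    refine ⟨fun h => h.1, fun h => ⟨h, fun N hN => ?_⟩⟩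
    obtain rfl : N = 0 := by omega
    exact isGood_of_size fun x hx => by have := h.size_pos x hx; omega
  | succ M ih =>
    rw [listSeries_goodBelow_succ hn hδ hγ (by omega : 0 < M + 1), ih, Finset.prod_range_succ]
    ring

end Good
-- Frobenius partitions as pairs of finite sets, and their series.
section FrobeniusSeries
open PowerSeries
variable {n : ℕ}

/-- Lets the strictly decreasing rows be replaced by finite sets, over which products of factors `1
+ t` expand. -/
theorem exists_sorted_list {α : Type*} [DecidableEq α] (r : α → α → Prop) [DecidableRel r]
    (htot : ∀ x y, x ≠ y → r x y ∨ r y x) (htrans : ∀ x y z, r x y → r y z → r x z)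
    (hirr : ∀ x, ¬ r x x) (K : Finset α) : ∃! l : List α, l.Pairwise r ∧ l.toFinset = K := by
  let s : α → α → Prop := fun x y => x = y ∨ r x y
  have : DecidableRel s := fun x y => inferInstanceAs (Decidable (x = y ∨ r x y))
  have h1 : IsTrans α s := ⟨by
    rintro x y z (rfl | h) (rfl | h')
    · exact Or.inl rfl
    · exact Or.inr h'
    · exact Or.inr h
    · exact Or.inr (htrans _ _ _ h h')⟩
  have h2 : Std.Total s := ⟨fun x y => by
    by_cases h : x = y
    · exact Or.inl (Or.inl h)
    · exact (htot x y h).imp Or.inr Or.inr⟩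
  have h3 : Std.Antisymm s := ⟨by
    rintro x y (rfl | h) (h' | h')
    · rfl
    · rfl
    · exact h'.symm
    · exact absurd (htrans _ _ _ h h') (hirr x)⟩
  refine ⟨K.sort s, ⟨?_, by simp⟩, ?_⟩
  · have := (K.pairwise_sort s).and (K.sort_nodup s)
    exact this.imp fun {x y} h => h.1.resolve_left h.2
  · rintro l ⟨hl, rfl⟩
    have hnd : l.Nodup := hl.imp fun {x y} h => by rintro rfl; exact hirr _ h
    refine List.Perm.eq_of_pairwise (le := s) ?_ (hl.imp Or.inr) (Finset.pairwise_sort _ _) ?_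
    · exact fun x y _ _ h h' => h3.antisymm x y h h'
    · rw [List.perm_ext_iff_of_nodup hnd (Finset.sort_nodup _ _)]
      simp

/-- The weight of a Frobenius partition in terms of the colours. -/
noncomputable def Frobenius.colourWeight (f : Frobenius n) : ColourRing n :=
  (f.upper.map fun x => aSymb n x.2).prod * (f.lower.map fun x => bSymb n x.2).prod

theorem coeff_rowPoly_eq_sum (c : ℕ → PowerSeries (ColourRing n)) (M r : ℕ) :
    (rowPoly n c M).coeff r = ∑ K ∈ Finset.powersetCard r
      (Finset.range M ×ˢ (Finset.univ : Finset (Fin n))), ∏ x ∈ K, (c x.2 * X ^ x.1) := by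
  rw [rowPoly, Finset.prod_range, Finset.prod_comm, ← Finset.prod_product',
    Finset.prod_one_add, Polynomial.finsetSum_coeff]
  rw [Finset.powersetCard_eq_filter, Finset.sum_filter]
  refine Finset.sum_congr rfl fun K _ => ?_
  rw [Finset.prod_mul_distrib, Finset.prod_const, ← map_prod, Polynomial.coeff_C_mul_X_pow]
  simp only [eq_comm]

theorem prod_mul_X_pow (K : Finset (ℕ × Fin n)) (c : ℕ → ColourRing n) (e : ℕ) :
    ∏ x ∈ K, (C (c x.2) * X ^ e * X ^ x.1 : PowerSeries (ColourRing n))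
      = C (∏ x ∈ K, c x.2) * X ^ (e * K.card + ∑ x ∈ K, x.1) := by
  simp only [Finset.prod_mul_distrib, Finset.prod_const, Finset.prod_pow_eq_pow_sum, map_prod,
    pow_add, pow_mul, mul_assoc]

theorem existsUnique_upper (K : Finset (ℕ × Fin n)) :
    ∃! l : List (ℕ × Fin n),
      (l.Pairwise fun x y => y.1 < x.1 ∨ (y.1 = x.1 ∧ x.2 < y.2)) ∧ l.toFinset = K := by
  refine exists_sorted_list _ ?_ ?_ ?_ K
  · rintro ⟨p, i⟩ ⟨q, j⟩ h
    simp only [ne_eq, Prod.mk.injEq] at h ⊢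
    omega
  · rintro ⟨p, i⟩ ⟨q, j⟩ ⟨r, k⟩ h h'
    simp only at h h' ⊢
    omega
  · rintro ⟨p, i⟩ h
    simp at h

theorem existsUnique_lower (K : Finset (ℕ × Fin n)) :
    ∃! l : List (ℕ × Fin n),
      (l.Pairwise fun x y => y.1 < x.1 ∨ (y.1 = x.1 ∧ y.2 < x.2)) ∧ l.toFinset = K := by
  refine exists_sorted_list _ ?_ ?_ ?_ K
  · rintro ⟨p, i⟩ ⟨q, j⟩ h
    simp only [ne_eq, Prod.mk.injEq] at h ⊢
    omega
  · rintro ⟨p, i⟩ ⟨q, j⟩ ⟨r, k⟩ h h'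
    simp only at h h' ⊢
    omega
  · rintro ⟨p, i⟩ h
    simp at h

theorem Frobenius.nodup_upper (f : Frobenius n) : f.upper.Nodup :=
  f.upper_decreasing.imp fun {x y} h => by rintro rfl; simp at h

theorem Frobenius.nodup_lower (f : Frobenius n) : f.lower.Nodup :=
  f.lower_decreasing.imp fun {x y} h => by rintro rfl; simp at h

/-- The pairs of sets of coloured integers that are the rows of Frobenius partitions of `m`. -/
noncomputable def rowPairs (n m r : ℕ) : Finset (Finset (ℕ × Fin n) × Finset (ℕ × Fin n)) :=
  ((Finset.powersetCard r (Finset.range (m + 1) ×ˢ Finset.univ)) ×ˢ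
    (Finset.powersetCard r (Finset.range (m + 1) ×ˢ Finset.univ))).filter
    fun p => p.1.card + ∑ x ∈ p.1, x.1 + ∑ x ∈ p.2, x.1 = m

theorem bijOn_toFinset (m : ℕ) :
    Set.BijOn (fun f : Frobenius n => (f.upper.toFinset, f.lower.toFinset))
      {f | f.weight = m} ((Finset.range (m + 1)).biUnion (rowPairs n m) : Finset _) := by
  refine ⟨?_, ?_, ?_⟩
  · rintro f rfl
    have h1 := List.toFinset_card_of_nodup f.nodup_upper
    have h2 := List.toFinset_card_of_nodup f.nodup_lower
    have e := f.length_eq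
    have hw : f.weight = f.upper.length + (f.upper.map Prod.fst).sum
      + (f.lower.map Prod.fst).sum := rfl
    simp only [Finset.coe_biUnion, Set.mem_iUnion, Finset.mem_coe, rowPairs, Finset.mem_filter,
      Finset.mem_product, Finset.mem_powersetCard]
    refine ⟨f.upper.length, by simp only [Finset.mem_range]; omega,
      ⟨⟨?_, h1⟩, ⟨?_, by omega⟩⟩, ?_⟩
    · intro x hx
      have := List.le_sum_of_mem (List.mem_map_of_mem (f := Prod.fst) (List.mem_toFinset.mp hx))
      simp only [Finset.mem_product, Finset.mem_range, Finset.mem_univ, and_true]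
      omega
    · intro x hx
      have := List.le_sum_of_mem (List.mem_map_of_mem (f := Prod.fst) (List.mem_toFinset.mp hx))
      simp only [Finset.mem_product, Finset.mem_range, Finset.mem_univ, and_true]
      omega
    · rw [h1, List.sum_toFinset _ f.nodup_upper, List.sum_toFinset _ f.nodup_lower]
      rfl
  · intro f _ g _ h
    simp only [Prod.mk.injEq] at h
    have h1 := (existsUnique_upper g.upper.toFinset).unique ⟨f.upper_decreasing, h.1⟩
      ⟨g.upper_decreasing, rfl⟩
    have h2 := (existsUnique_lower g.lower.toFinset).unique ⟨f.lower_decreasing, h.2⟩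
      ⟨g.lower_decreasing, rfl⟩
    cases f
    cases g
    simp only at h1 h2
    subst h1 h2
    rfl
  · rintro ⟨K, L⟩ h
    simp only [Finset.coe_biUnion, Set.mem_iUnion, Finset.mem_coe, rowPairs, Finset.mem_filter,
      Finset.mem_product, Finset.mem_powersetCard] at h
    obtain ⟨r, -, ⟨⟨-, h1⟩, ⟨-, h2⟩⟩, h3⟩ := h
    obtain ⟨u, ⟨hu, rfl⟩, -⟩ := existsUnique_upper K
    obtain ⟨v, ⟨hv, rfl⟩, -⟩ := existsUnique_lower L
    have nu : u.Nodup := hu.imp fun {x y} h => by rintro rfl; simp at h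
    have nv : v.Nodup := hv.imp fun {x y} h => by rintro rfl; simp at h
    rw [List.toFinset_card_of_nodup nu] at h1 h3
    rw [List.toFinset_card_of_nodup nv] at h2
    rw [List.sum_toFinset _ nu, List.sum_toFinset _ nv] at h3
    exact ⟨⟨u, v, h1.trans h2.symm, hu, hv⟩, h3, rfl⟩

/-- The index `r` is the common length of the rows. The extra `q` in each upper factor contributes
the summand `s` of the weight. -/
theorem coeff_sum_rowPoly (m : ℕ) :
    ∑ r ∈ Finset.range (m + 1), coeff m
      ((rowPoly n (fun i => C (aSymb n i) * X) (m + 1)).coeff r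
        * (rowPoly n (fun i => C (bSymb n i)) (m + 1)).coeff r)
      = ∑ᶠ f ∈ {f : Frobenius n | f.weight = m}, f.colourWeight := by
  rw [finsum_mem_eq_of_bijOn (g := fun p : Finset (ℕ × Fin n) × Finset (ℕ × Fin n) =>
    (∏ x ∈ p.1, aSymb n x.2) * ∏ x ∈ p.2, bSymb n x.2) _ (bijOn_toFinset m),
    finsum_mem_coe_finset, Finset.sum_biUnion]
  · refine Finset.sum_congr rfl fun r _ => ?_
    rw [coeff_rowPoly_eq_sum, coeff_rowPoly_eq_sum, Finset.sum_mul_sum, ← Finset.sum_product',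
      map_sum, rowPairs, Finset.sum_filter]
    refine Finset.sum_congr rfl fun p _ => ?_
    have h1 := prod_mul_X_pow p.1 (aSymb n) 1
    have h2 := prod_mul_X_pow p.2 (bSymb n) 0
    simp only [pow_one, pow_zero, mul_one, one_mul, zero_mul, zero_add] at h1 h2
    rw [h1, h2, mul_mul_mul_comm, ← map_mul, ← pow_add, coeff_C_mul_X_pow]
    simp only [eq_comm]
  · intro r _ s _ hrs
    rw [Function.onFun, Finset.disjoint_left]
    intro p hp hp'
    simp only [rowPairs, Finset.mem_filter, Finset.mem_product, Finset.mem_powersetCard] at hp hp'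
    exact hrs (hp.1.1.2.symm.trans hp'.1.1.2)
  · intro f _
    simp only
    rw [List.prod_toFinset _ f.nodup_upper, List.prod_toFinset _ f.nodup_lower]
    rfl

theorem prod_map_aSymb {α : Type*} (l : List α) (f : α → ℕ) :
    (l.map fun x => aSymb n (f x)).prod
      = monom fun i => (l.countP (fun x => decide (f x = (i : ℕ))) : ℤ) := by
  induction l with
  | nil => exact monom_zero.symm
  | cons x l ih =>
    rw [List.map_cons, List.prod_cons, ih, aSymb, monom_mul_monom]
    congr 1
    ext i
    simp only [Pi.add_apply, List.countP_cons, decide_eq_true_eq]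
    push_cast
    ring

theorem prod_map_bSymb {α : Type*} (l : List α) (f : α → ℕ) :
    (l.map fun x => bSymb n (f x)).prod
      = monom fun i => -(l.countP (fun x => decide (f x = (i : ℕ))) : ℤ) := by
  induction l with
  | nil => simp [← monom_zero]; rfl
  | cons x l ih =>
    rw [List.map_cons, List.prod_cons, ih, bSymb, monom_mul_monom]
    congr 1
    ext i
    simp only [Pi.add_apply, List.countP_cons, decide_eq_true_eq]
    split_ifs <;> push_cast <;> ring

/-- The generating function of the sizes of the fibres of `w` is a sum over the objects. -/
theorem genSeries_ncard {α : Type*} (S : ℕ → Set α) (hS : ∀ m, (S m).Finite)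
    (w : α → (Fin n → ℕ) × (Fin n → ℕ)) (m : ℕ) :
    coeff m (genSeries fun m u v => {x | x ∈ S m ∧ w x = (u, v)}.ncard)
      = ∑ᶠ x ∈ S m, monom fun i => ((w x).1 i : ℤ) - ((w x).2 i : ℤ) := by
  classical
  rw [genSeries, coeff_mk]
  obtain ⟨T, hT⟩ : ∃ T : Finset α, (T : Set α) = S m := ⟨(hS m).toFinset, (hS m).coe_toFinset⟩
  rw [← hT, finsum_mem_coe_finset]
  have h : ∀ y, {x | x ∈ (T : Set α) ∧ w x = y} = (T.filter fun x => w x = y : Finset α) := by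
    intro y
    ext x
    simp
  rw [finsum_eq_sum_of_support_subset (s := T.image w)]
  · rw [← Finset.sum_fiberwise_of_maps_to (g := w) (t := T.image w)
      (fun x hx => Finset.mem_image_of_mem _ hx)]
    refine Finset.sum_congr rfl fun y _ => ?_
    rw [Finset.sum_congr rfl (g := fun _ => monom fun i => (y.1 i : ℤ) - (y.2 i : ℤ))]
    · rw [Finset.sum_const, nsmul_eq_mul]
      simp only [Prod.mk.eta]
      rw [h, Set.ncard_coe_finset]
    · intro x hx
      rw [(Finset.mem_filter.mp hx).2]
  · intro y hy
    rw [Finset.mem_coe]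
    by_contra hn
    refine hy ?_
    simp only [Prod.mk.eta]
    rw [h, Set.ncard_coe_finset, Finset.filter_false_of_mem, Finset.card_empty]
    · simp
    · rintro x hx rfl
      exact hn (Finset.mem_image_of_mem _ hx)

theorem genSeries_frobeniusCount :
    genSeries (frobeniusCount n) = coeffX0 (frobeniusProduct n) := by
  ext1 m
  rw [coeff_coeffX0_frobeniusProduct, coeff_sum_rowPoly]
  have h := genSeries_ncard (fun m => {f : Frobenius n | f.weight = m}) (finite_frobenius n)
    (fun f => (fun i : Fin n => f.upper.countP (fun x => decide (x.2 = i)),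
      fun i : Fin n => f.lower.countP (fun x => decide (x.2 = i)))) m
  rw [show frobeniusCount n = fun m u v => {f : Frobenius n | f ∈ {f : Frobenius n | f.weight = m} ∧
    ((fun i : Fin n => f.upper.countP (fun x => decide (x.2 = i))),
      (fun i : Fin n => f.lower.countP (fun x => decide (x.2 = i)))) = (u, v)}.ncard from ?_, h]
  · refine finsum_mem_congr rfl fun f _ => ?_
    rw [Frobenius.colourWeight, prod_map_aSymb, prod_map_bSymb, monom_mul_monom]
    congr 1
    ext i
    simp [Fin.ext_iff, sub_eq_add_neg]
  · funext m u v
    rw [frobeniusCount, frobeniusSet]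
    congr 1
    ext f
    simp only [Set.mem_ofPred_eq, Prod.mk.injEq, funext_iff]

end FrobeniusSeries

/-! ### Avoiding the patterns is the same as being good at every size. -/

section Patterns
variable {n : ℕ} {δ : Colour → ℤ} {γ : Colour → Colour → ℤ}

theorem leftNeighbour_eq_none {M : ℕ} {x : Part} (hx : 3 * M + 1 < partKey x)
    (h : leftNeighbour M (some x) = none) :
    (x.size = M + 1 ∧ x.colour.1 ≤ x.colour.2) ∨ M + 2 ≤ x.size := by
  obtain ⟨p, k, l⟩ := x
  unfold leftNeighbour at h
  unfold partKey at hx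
  simp only at h hx ⊢
  split_ifs at h hx <;> omega

theorem rightNeighbour_eq_none {M : ℕ} {y : Part} (hy : partKey y < 3 * M + 1)
    (h : rightNeighbour M (some y) = none) :
    (y.size + 1 = M ∧ y.colour.2 ≤ y.colour.1) ∨ y.size + 2 ≤ M := by
  obtain ⟨p, k, l⟩ := y
  unfold rightNeighbour at h
  unfold partKey at hy
  simp only at h hy ⊢
  split_ifs at h hy <;> omega

/-- Keys are monotone, so strict inequalities at the two neighbours extend to all other parts. -/
theorem isSplit_of_neighbours {M i : ℕ} {H T : List Part}
    (h : (H ++ ([part M i i] ++ T)).IsChain StepDown)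
    (hH : ∀ x ∈ H.getLast?, 3 * M + 1 < partKey x)
    (hT : ∀ y ∈ T.head?, partKey y < 3 * M + 1) : IsSplit M H [part M i i] T := by
  have hp := pairwise_partKey h
  rw [List.pairwise_append, List.pairwise_append] at hp
  refine ⟨fun x hx => ?_, fun x hx => ?_, fun y hy => ?_⟩
  · obtain ⟨z, hz⟩ : ∃ z, H.getLast? = some z :=
      Option.ne_none_iff_exists'.mp fun h' => by
        rw [List.getLast?_eq_none_iff.mp h'] at hx
        simp at hx
    have h1 := hH z hz
    obtain ⟨s, rfl⟩ := List.getLast?_eq_some_iff.mp hz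
    rcases List.mem_append.mp hx with hx | hx
    · have := (List.pairwise_append.mp hp.1).2.2 x hx z (by simp)
      omega
    · obtain rfl : x = z := by simpa using hx
      exact h1
  · exact partKey_eq_iff.mpr ⟨i, by simpa using hx⟩
  · obtain ⟨z, hz⟩ : ∃ z, T.head? = some z :=
      Option.ne_none_iff_exists'.mp fun h' => by
        rw [List.head?_eq_none_iff.mp h'] at hy
        simp at hy
    have h1 := hT z hz
    obtain ⟨s, rfl⟩ := List.head?_eq_some_iff.mp hz
    rcases List.mem_cons.mp hy with rfl | hy
    · exact h1
    · have := List.rel_of_pairwise_cons hp.2.1.2.1 hy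
      omega

theorem IsGood.ne_forbidden {M i : ℕ} {H T : List Part}
    (hg : IsGood δ γ M (H ++ ([part M i i] ++ T)))
    (h : (H ++ ([part M i i] ++ T)).IsChain StepDown)
    (hH : ∀ x ∈ H.getLast?, 3 * M + 1 < partKey x)
    (hT : ∀ y ∈ T.head?, partKey y < 3 * M + 1) :
    (i : ℤ) ≠ forbidden δ γ M H.getLast? T.head? := by
  have s := isSplit_of_neighbours h hH hT
  unfold IsGood at hg
  rw [s.freeParts_eq, s.partsAbove_eq, s.partsBelow_eq] at hg
  rcases hg with hg | ⟨x, hx, hg⟩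
  · simp at hg
  · obtain rfl := (List.cons.inj hx).1
    exact hg

theorem ne_forbidden_of_infix {l : List Part} (h : l.IsChain StepDown)
    (hg : ∀ M, IsGood δ γ M l) {M i : ℕ} {x y : Part} (hx : 3 * M + 1 < partKey x)
    (hy : partKey y < 3 * M + 1) (hi : [x, part M i i, y] <:+: l) :
    (i : ℤ) ≠ forbidden δ γ M (some x) (some y) := by
  obtain ⟨s, t, rfl⟩ := hi
  have e : s ++ [x, part M i i, y] ++ t = (s ++ [x]) ++ ([part M i i] ++ (y :: t)) := by simp
  have hgM := hg M
  rw [e] at h hgM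
  simpa using hgM.ne_forbidden h (by simpa using hx) (by simpa using hy)

theorem ne_forbidden_of_prefix {l : List Part} (h : l.IsChain StepDown)
    (hg : ∀ M, IsGood δ γ M l) {M i : ℕ} {y : Part}
    (hy : partKey y < 3 * M + 1) (hi : [part M i i, y] <+: l) :
    (i : ℤ) ≠ forbidden δ γ M none (some y) := by
  obtain ⟨t, rfl⟩ := hi
  have e : [part M i i, y] ++ t = [] ++ ([part M i i] ++ (y :: t)) := by simp
  have hgM := hg M
  rw [e] at h hgM
  simpa using hgM.ne_forbidden h (by simp) (by simpa using hy)

theorem ne_forbidden_of_suffix {l : List Part} (h : l.IsChain StepDown)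
    (hg : ∀ M, IsGood δ γ M l) {M i : ℕ} {x : Part} (hx : 3 * M + 1 < partKey x)
    (hi : [x, part M i i] <:+ l) :
    (i : ℤ) ≠ forbidden δ γ M (some x) none := by
  obtain ⟨s, rfl⟩ := hi
  have e : s ++ [x, part M i i] = (s ++ [x]) ++ ([part M i i] ++ []) := by simp
  have hgM := hg M
  rw [e] at h hgM
  simpa using hgM.ne_forbidden h (by simpa using hx) (by simp)

/-- Two free parts of size `M` would be equal, hence a repetition or `a_0 b_0`. For a single one,
five of the nine kinds of neighbour pairs are avoided patterns; in the other four the forbidden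
index is 0, which `no_zero` excludes. -/
theorem IsCapparelli.isGood {l : List Part} (h : IsCapparelli n δ γ l) (M : ℕ) :
    IsGood δ γ M l := by
  have hp := isPrimc_iff.mp h.primc
  have hs := split_of_isChain M hp.2
  have s := isSplit M l
  unfold IsGood
  generalize partsAbove M l = H at *
  generalize freeParts M l = F at *
  generalize partsBelow M l = T at *
  subst hs
  match F with
  | [] => exact Or.inl rfl
  | f :: g :: F =>
    exfalso
    obtain ⟨i, rfl⟩ := partKey_eq_iff.mp (s.free f (by simp))
    have hfg : StepDown (part M i i) g :=
      (List.isChain_cons.mp (List.isChain_append.mp hp.2).2.1).1 g rfl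
    obtain rfl := hfg.eq_of_partKey (s.free _ (by simp)) (s.free g (by simp))
    rcases Nat.eq_zero_or_pos i with rfl | hi
    · exact h.no_zero (part M 0 0) (by simp) rfl
    · exact h.no_repeat M i hi (hp.1 (part M i i) (by simp)).2.1 ⟨H, F ++ T, by simp⟩
  | [f] =>
    obtain ⟨i, rfl⟩ := partKey_eq_iff.mp (s.free f (by simp))
    refine Or.inr ⟨_, rfl, fun hi => ?_⟩
    simp only at hi
    have h0 : i ≠ 0 := by
      rintro rfl
      exact h.no_zero (part M 0 0) (by simp) rfl
    have hL : ∀ x ∈ H.getLast?, 3 * M + 1 < partKey x :=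
      fun x hx => s.above x (List.mem_of_getLast? hx)
    have hR : ∀ y ∈ T.head?, partKey y < 3 * M + 1 :=
      fun y hy => s.below y (List.mem_of_head? hy)
    have hinf : ∀ x y, H.getLast? = some x → T.head? = some y →
        [x, part M i i, y] <:+: H ++ ([part M i i] ++ T) := by
      intro x y hx hy
      obtain ⟨u, rfl⟩ := List.getLast?_eq_some_iff.mp hx
      obtain ⟨v, rfl⟩ := List.head?_eq_some_iff.mp hy
      exact ⟨u, v, by simp⟩
    have hLR : ∀ x y, H.getLast? = some x → T.head? = some y → StepDown x y := by
      intro x y hx hy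
      -- Compatibility of the two neighbours, obtained by deleting the free part, gives the side
      -- conditions of the `γ` patterns.
      have := List.isChain_append.mp (isChain_remove hp.2)
      exact this.2.2 x hx y hy
    unfold forbidden at hi
    rcases leftNeighbour_cases hL with ⟨eL, -⟩ | ⟨k, l, hx, hkl, eL⟩ | ⟨k, l, hx, hkl, eL⟩ <;>
    rcases rightNeighbour_cases hR with ⟨eR, -⟩ | ⟨k', l', hy, hkl', eR⟩ |
      ⟨p, k', l', rfl, hy, hkl', eR⟩ <;>
    rw [eL, eR] at hi <;> unfold forbiddenIndex at hi
    · exact h0 (Nat.cast_eq_zero.mp hi)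
    · cases hx : H.getLast? with
      | none =>
        obtain rfl := List.getLast?_eq_none_iff.mp hx
        obtain ⟨v, rfl⟩ := List.head?_eq_some_iff.mp hy
        exact h.avoid_left_end M k' l' i hkl' hi ⟨v, by simp⟩
      | some x =>
        rw [hx] at eL
        obtain ⟨q, k, l⟩ := x
        have hpat := hinf _ _ hx hy
        rcases leftNeighbour_eq_none (hL _ hx) eL with ⟨h1, h2⟩ | h1
        · simp only at h1 h2
          subst h1
          exact h.avoid_left_le M k l k' l' i hkl' h2 hi hpat
        · simp only at h1
          obtain ⟨u, rfl⟩ := Nat.exists_eq_add_of_le h1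
          rw [add_assoc] at hpat
          exact h.avoid_left_far M (2 + u) k l k' l' i hkl' (by omega) hi hpat
    · exact h0 (Nat.cast_eq_zero.mp hi)
    · cases hy : T.head? with
      | none =>
        obtain rfl := List.head?_eq_none_iff.mp hy
        obtain ⟨v, rfl⟩ := List.getLast?_eq_some_iff.mp hx
        exact h.avoid_right_end M k l i hkl hi ⟨v, by simp⟩
      | some y =>
        rw [hy] at eR
        obtain ⟨q, k', l'⟩ := y
        have hpat := hinf _ _ hx hy
        rcases rightNeighbour_eq_none (hR _ hy) eR with ⟨h1, h2⟩ | h1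
        · simp only at h1 h2
          subst h1
          exact h.avoid_right_ge q k l k' l' i hkl h2 hi hpat
        · simp only at h1
          obtain ⟨u, rfl⟩ : ∃ u, M = q + (2 + u) := ⟨M - q - 2, by omega⟩
          exact h.avoid_right_far q (2 + u) k l k' l' i hkl (by omega) hi hpat
    · have hst := hLR _ _ hx hy
      refine h.avoid_middle M k l k' l' i ?_ hi (hinf _ _ hx hy)
      unfold StepDown deltaNat at hst
      simp only at hst
      split_ifs at hst <;> omega
    · have hst := hLR _ _ hx hy
      refine h.avoid_right_lt p k l k' l' i hkl hkl' (nonempty_interval_diff ?_ hkl) hi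
        (hinf _ _ hx hy)
      unfold StepDown deltaNat at hst
      simp only at hst
      split_ifs at hst <;> omega
    · exact h0 (Nat.cast_eq_zero.mp hi)
    · have hst := hLR _ _ hx hy
      refine h.avoid_left_gt M k l k' l' i hkl' hkl (nonempty_interval_diff ?_ hkl') hi
        (hinf _ _ hx hy)
      unfold StepDown deltaNat at hst
      simp only at hst
      split_ifs at hst <;> omega
    · exact h0 (Nat.cast_eq_zero.mp hi)

/-- In each three-part or end pattern, the prescribed `δ` or `γ` value is `forbidden` for the
neighbours in that pattern. -/
theorem IsPrimc.isCapparelli {l : List Part} (h : IsPrimc n l) (hg : ∀ M, IsGood δ γ M l) :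
    IsCapparelli n δ γ l := by
  have hc := (isPrimc_iff.mp h).2
  refine ⟨h, ?_, ?_, ?_, ?_, ?_, ?_, ?_, ?_, ?_, ?_, ?_⟩
  · rintro ⟨M, c⟩ hx rfl
    have hs := split_of_isChain M hc
    have s := isSplit M l
    have hmem : part M 0 0 ∈ freeParts M l := by
      rw [freeParts, List.mem_filter]
      exact ⟨hx, by simp [partKey]⟩
    rcases hg M with h1 | ⟨x, h1, h2⟩
    · rw [h1] at hmem
      simp at hmem
    · rw [h1] at hmem s hs
      obtain rfl : part M 0 0 = x := by simpa using hmem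
      rw [← hs, List.isChain_append, List.isChain_append] at hc
      -- A part `a_0 b_0` that is present is admissible, and is then the forbidden one.
      refine h2 (forbidden_eq_zero (fun x hx => s.above x (List.mem_of_getLast? hx))
        (fun y hy => s.below y (List.mem_of_head? hy)) (fun x hx => ?_) fun y hy => ?_).symm
      · exact hc.2.2 x hx _ rfl
      · exact hc.2.1.2.2 _ rfl y hy
  · rintro p i - - ⟨s, t, rfl⟩
    have : (freeParts p (s ++ [part p i i, part p i i] ++ t)).length ≤ 1 := by
      rcases hg p with h1 | ⟨x, h1, -⟩ <;> rw [h1] <;> simp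
    simp [freeParts, List.filter_append, partKey] at this
    omega
  · intro p k₁ l₁ k₂ l₂ i h1 hi hp
    refine ne_forbidden_of_infix hc hg ?_ ?_ hp (hi.trans ?_)
    · simp only [partKey]; split_ifs <;> omega
    · simp only [partKey]; split_ifs <;> omega
    · simp [forbidden, leftNeighbour, rightNeighbour, forbiddenIndex]
  · intro p u k₁ l₁ k₂ l₂ i h1 h2 hi hp
    refine ne_forbidden_of_infix hc hg ?_ ?_ hp (hi.trans ?_)
    · simp only [partKey]; split_ifs <;> omega
    · simp only [partKey]; split_ifs <;> omega
    · rw [forbidden, leftNeighbour, rightNeighbour, if_neg (by simp; omega),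
        if_neg (by simp; omega), if_pos rfl, forbiddenIndex]
  · intro p k₂ l₂ i h1 hi hp
    refine ne_forbidden_of_prefix hc hg ?_ hp (hi.trans ?_)
    · simp only [partKey]; split_ifs <;> omega
    · simp [forbidden, leftNeighbour, rightNeighbour, forbiddenIndex]
  · intro p k₁ l₁ k₂ l₂ i h1 h2 hi hp
    refine ne_forbidden_of_infix hc hg ?_ ?_ hp (hi.trans ?_)
    · simp only [partKey]; split_ifs <;> omega
    · simp only [partKey]; split_ifs <;> omega
    · rw [forbidden, leftNeighbour, rightNeighbour, if_neg (by simp),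
        if_neg (by simp; omega), if_pos rfl, forbiddenIndex]
  · intro p k₁ l₁ k₂ l₂ i h1 h2 h3 hi hp
    refine ne_forbidden_of_infix hc hg ?_ ?_ hp (hi.trans ?_)
    · simp only [partKey]; split_ifs <;> omega
    · simp only [partKey]; split_ifs <;> omega
    · rw [forbidden, leftNeighbour, rightNeighbour, if_neg (by simp),
        if_pos ⟨rfl, h2⟩, if_pos rfl, forbiddenIndex]
  · intro p u k₁ l₁ k₂ l₂ i h1 h2 hi hp
    refine ne_forbidden_of_infix hc hg ?_ ?_ hp (hi.trans ?_)
    · simp only [partKey]; split_ifs; omega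
    · simp only [partKey]; split_ifs <;> omega
    · rw [forbidden, leftNeighbour, rightNeighbour, if_pos rfl, if_neg (by simp; omega),
        if_neg (by simp; omega), forbiddenIndex]
  · intro p k₁ l₁ i h1 hi hp
    refine ne_forbidden_of_suffix hc hg ?_ hp (hi.trans ?_)
    · simp only [partKey]; split_ifs; omega
    · simp [forbidden, leftNeighbour, rightNeighbour, forbiddenIndex]
  · intro p k₁ l₁ k₂ l₂ i h1 h2 hi hp
    refine ne_forbidden_of_infix hc hg ?_ ?_ hp (hi.trans ?_)
    · simp only [partKey]; split_ifs; omega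
    · simp only [partKey]; split_ifs <;> omega
    · rw [forbidden, leftNeighbour, rightNeighbour, if_pos rfl, if_neg (by simp),
        if_neg (by simp; omega), forbiddenIndex]
  · intro p k₁ l₁ k₂ l₂ i h1 h2 h3 hi hp
    refine ne_forbidden_of_infix hc hg ?_ ?_ hp (hi.trans ?_)
    · simp only [partKey]; split_ifs; omega
    · simp only [partKey]; split_ifs; omega
    · rw [forbidden, leftNeighbour, rightNeighbour, if_pos rfl, if_neg (by simp),
        if_pos ⟨rfl, h2⟩, forbiddenIndex]

theorem isCapparelli_iff {l : List Part} :
    IsCapparelli n δ γ l ↔ IsPrimc n l ∧ ∀ M, IsGood δ γ M l :=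
  ⟨fun h => ⟨h.primc, h.isGood⟩, fun h => h.1.isCapparelli h.2⟩

end Patterns

/-! ### Letting the size bound tend to infinity. -/

section Main
open PowerSeries
variable {n : ℕ} {δ : Colour → ℤ} {γ : Colour → Colour → ℤ}

theorem listWeight_eq_monom (l : List Part) : listWeight n l = monom fun i : Fin n =>
    (l.countP (fun x : Part => decide (x.colour.1 = (i : ℕ))) : ℤ)
      - (l.countP (fun x : Part => decide (x.colour.2 = (i : ℕ))) : ℤ) := by
  rw [listWeight, List.prod_map_mul, prod_map_aSymb, prod_map_bSymb, monom_mul_monom]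
  rfl

theorem genSeries_capparelliCount :
    genSeries (capparelliCount n δ γ) = listSeries n {l | IsCapparelli n δ γ l} := by
  ext1 m
  have h := genSeries_ncard (fun m => {l : List Part | IsCapparelli n δ γ l ∧
      (l.map Part.size).sum = m}) (fun m => finite_capparelli n m δ γ)
    (fun l => (fun i : Fin n => l.countP (fun x : Part => decide (x.colour.1 = (i : ℕ))),
      fun i : Fin n => l.countP (fun x : Part => decide (x.colour.2 = (i : ℕ))))) m
  have e : capparelliCount n δ γ = fun m u v =>
      {l : List Part | l ∈ {l : List Part | IsCapparelli n δ γ l ∧ (l.map Part.size).sum = m} ∧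
        ((fun i : Fin n => l.countP (fun x : Part => decide (x.colour.1 = (i : ℕ)))),
        (fun i : Fin n => l.countP (fun x : Part => decide (x.colour.2 = (i : ℕ)))))
          = (u, v)}.ncard := by
    funext m u v
    rw [capparelliCount, capparelliSet]
    congr 1
    ext l
    simp only [Set.mem_ofPred_eq, Prod.mk.injEq, funext_iff, and_assoc]
  rw [e, h, listSeries, coeff_mk]
  exact finsum_mem_congr rfl fun l _ => (listWeight_eq_monom l).symm

theorem listSeries_isCapparelli (hn : 0 < n) (hδ : Condition1 δ) (hγ : Condition2 γ) :
    listSeries n {l | IsCapparelli n δ γ l} = qPochhammer X * listSeries n {l | IsPrimc n l} := by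
  ext1 m
  -- A partition of `m` has no part larger than `m`, so goodness at larger sizes is automatic.
  have h1 : coeff m (listSeries n {l | IsCapparelli n δ γ l})
      = coeff m (listSeries n (goodBelow n δ γ (m + 1 + 1))) := by
    rw [listSeries, listSeries, coeff_mk, coeff_mk]
    refine finsum_mem_congr (Set.ext fun l => ?_) fun _ _ => rfl
    simp only [sizeFiber, goodBelow, Set.mem_ofPred_eq, isCapparelli_iff]
    constructor
    · rintro ⟨⟨h1, h2⟩, h3⟩
      exact ⟨⟨h1, fun N _ => h2 N⟩, h3⟩
    · rintro ⟨⟨h1, h2⟩, h3⟩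
      refine ⟨⟨h1, fun N => ?_⟩, h3⟩
      by_cases hN : N < m + 1 + 1
      · exact h2 N hN
      · refine isGood_of_size fun x hx => ?_
        have : x.size ≤ listSize l := List.le_sum_of_mem (List.mem_map_of_mem hx)
        omega
  rw [h1, listSeries_goodBelow hn hδ hγ, ← sub_eq_zero, ← map_sub, ← sub_mul, ← neg_sub, neg_mul,
    map_neg, neg_eq_zero]
  have h2 := X_pow_dvd_qPochhammer_sub (X : PowerSeries (ColourRing n)) (m + 1)
  simp only [← pow_succ'] at h2
  exact X_pow_dvd_iff.mp (h2.mul_right _) m (Nat.lt_succ_self m)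

end Main
end Capparelli

theorem mainTheorem3 (n : ℕ) (hn : 0 < n) (δ : Capparelli.Colour → ℤ)
    (γ : Capparelli.Colour → Capparelli.Colour → ℤ)
    (hδ : Capparelli.Condition1 δ) (hγ : Capparelli.Condition2 γ) :
    Capparelli.genSeries (Capparelli.capparelliCount n δ γ) =
        Capparelli.qPochhammer PowerSeries.X *
          Capparelli.genSeries (Capparelli.frobeniusCount n) ∧
      Capparelli.genSeries (Capparelli.capparelliCount n δ γ) =
        Capparelli.qPochhammer PowerSeries.X *
          Capparelli.coeffX0 (Capparelli.frobeniusProduct n) := by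
  rw [Capparelli.genSeries_frobeniusCount, Capparelli.genSeries_capparelliCount,
    Capparelli.listSeries_isCapparelli hn hδ hγ, Capparelli.listSeries_isPrimc hn]
  exact ⟨rfl, rfl⟩
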